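/- **Model.** Customers arrive at a single-server queue in a Poisson process of rate $\lambda>0$. Service times are exponential; the service rate can be set to $\mu_l$ (low, free of cost) or $\mu_h$ (high, cost $c>0$ per unit time), where $0<\mu_l<\mu_h$. Every admitted customer brings a reward $R\ge 0$. While $x$ customers are present a holding cost $h(x)$ per unit time is paid; $h:\mathbb N_0\to\mathbb R$ is nondecreasing and convex with $h(0)=0$. Profits are discounted at rate $\beta>0$. Put $\Lambda=\lambda+\mu_h$ and $\delta=\mu_h-\mu_l$; the time unit is chosen so that $\Lambda+\beta=1$. Decisions are taken at arrival and departure epochs (and at time $0$): at an arrival epoch whether to admit the arriving customer and which service rate to use, at a departure epoch only which service rate to use. The state at an epoch is $(x,i)\in\mathbb N_0\times\{0,1\}$, where $x$ is the number of customers present (not counting a customer who is just arriving) and $i=1$ if the epoch is an arrival epoch, $i=0$ otherwise. Let $\upsilon(x,i)$ be the supremum over all history-dependent policies of the expected total discounted net profit (rewards minus holding and service costs) over an infinite horizon from the initial state $(x,i)$ (joint problem), and let $\hat\upsilon(x,i)$ be the same supremum over the policies that always use the low service rate (admission-only subproblem). Put $\hat\epsilon=\upsilon-\hat\upsilon$,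 $\Delta(x)=\upsilon(x,0)-\upsilon(x+1,0)$ and $\hat\Delta(x)=\hat\upsilon(x,0)-\hat\upsilon(x+1,0)$. **Thresholds.** For $f:\mathbb N_0\to\mathbb R$ and $\theta\in\mathbb R$ let $T_f(\theta)=\sup\{k\ge 0: f(k)\le\theta\}\in\{-1,0,1,\dots\}\cup\{+\infty\}$, with $\sup\emptyset=-1$. The optimal service and admission thresholds of the joint problem are $B^s=1+T_\Delta(c/\delta)$ and $B^d=T_\Delta(R)$ (the low rate is used if and only if $x\le B^s$, and an arriving customer is admitted if and only if $x\le B^d$); the optimal admission threshold of the subproblem is $\hat B^d=T_{\hat\Delta}(R)$. **Growth assumption.** There is a constant $\theta>1$ with $h(x+1)\le\theta h(x)$ for all $x>0$, and there are a constant $\alpha\in[0,1)$ and an integer $J\ge 1$ such that $\Lambda^J\,[R+c+h(x+J)]\le\alpha\,[R+c+h(x)]$ for all $x\ge 0$. **Proposition.** Under these assumptions, if $B^s\ge B^d+1$, then $\hat B^d=B^d$, and $\hat\epsilon(x,i)=0$ for $i=0,1$ and all integers $x\ge0$ with $x\le B^s$. -/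

import Mathlib

open MeasureTheory ProbabilityTheory

/-- Data of the admission / service-rate control problem for a single-server Markovian queue:
arrival rate `lam`, low and high service rates `mul < muh`, admission reward `R`, cost rate `c` of
the high service rate (the low rate is free), holding cost rate `h`, discount rate `beta`, with the
time unit chosen so that `lam + muh + beta = 1`. -/
structure QueueModel where
  lam : ℝ
  mul : ℝ
  muh : ℝ
  R : ℝ
  c : ℝ
  h : ℕ → ℝ
  beta : ℝ
  lam_pos : 0 < lam
  mul_pos : 0 < mul
  mul_lt_muh : mul < muh
  R_nonneg : 0 ≤ R
  c_pos : 0 < c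
  h_zero : h 0 = 0
  h_mono : Monotone h
  h_convex : ∀ x, h (x + 1) - h x ≤ h (x + 2) - h (x + 1)
  beta_pos : 0 < beta
  normalized : lam + muh + beta = 1

namespace QueueModel

/-- States `(x, i)`: `x` customers are found at a decision epoch, and `i = true` (i.e. `i = 1`) if
the epoch is an arrival epoch, `i = false` (i.e. `i = 0`) if it is not. The customer arriving at an
arrival epoch is not counted in `x`. -/
abbrev State : Type := ℕ × Bool

/-- Actions `(admit, high)`: admission decision and service rate decision (`true` for `μ_h`). -/
abbrev Action : Type := Bool × Bool

/-- Actions of the joint problem: both decisions are free at arrival epochs; at the other epochs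
there is nobody to admit and only the service rate is chosen. -/
def jointActions (s : State) : Set Action := {a | a.1 = true → s.2 = true}

/-- Actions of the admission control subproblem: the service rate is always low. -/
def admissionActions (s : State) : Set Action := {a | a ∈ jointActions s ∧ a.2 = false}

/-- Whether a customer is admitted. -/
def admitted (s : State) (a : Action) : Bool := s.2 && a.1

/-- Number of customers in the system right after the decision. -/
def queueAfter (s : State) (a : Action) : ℕ := if admitted s a then s.1 + 1 else s.1

variable (M : QueueModel)

/-- Maximal transition rate `Λ`. -/
def Lam : ℝ := M.lam + M.muh

/-- `δ = μ_h - μ_l`. -/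
def delta : ℝ := M.muh - M.mul

/-- Rate of service completions after the decision (none if the system is empty). -/
def departureRate (s : State) (a : Action) : ℝ :=
  if queueAfter s a = 0 then 0 else if a.2 then M.muh else M.mul

/-- Rate at which the next epoch (arrival or departure) occurs after the decision. -/
def totalRate (s : State) (a : Action) : ℝ := M.lam + M.departureRate s a

theorem departureRate_nonneg (s : State) (a : Action) : 0 ≤ M.departureRate s a := by
  have h1 := M.mul_pos
  have h2 := M.mul_lt_muh
  unfold departureRate
  split_ifs <;> linarith

theorem totalRate_pos (s : State) (a : Action) : 0 < M.totalRate s a := by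
  have h1 := M.lam_pos
  have h2 := M.departureRate_nonneg s a
  unfold totalRate
  linarith

/-- Law of the state at the next epoch: an arrival with probability `λ / (λ + μ)`, and a departure
with probability `μ / (λ + μ)`, where `μ` is the current rate of service completions. -/
noncomputable def nextState (s : State) (a : Action) : Measure State :=
  ENNReal.ofReal (M.lam / M.totalRate s a) • Measure.dirac (queueAfter s a, true)
    + ENNReal.ofReal (M.departureRate s a / M.totalRate s a) •
        Measure.dirac (queueAfter s a - 1, false)

instance (s : State) (a : Action) : IsProbabilityMeasure (M.nextState s a) := by
  have hpos := M.totalRate_pos s a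
  have hd := M.departureRate_nonneg s a
  constructor
  simp only [nextState, Measure.add_apply, Measure.smul_apply, measure_univ, smul_eq_mul, mul_one]
  rw [← ENNReal.ofReal_add (div_nonneg M.lam_pos.le hpos.le) (div_nonneg hd hpos.le), ← add_div]
  have : M.lam + M.departureRate s a = M.totalRate s a := rfl
  rw [this, div_self hpos.ne', ENNReal.ofReal_one]

instance (s : State) (a : Action) : IsProbabilityMeasure (expMeasure (M.totalRate s a)) :=
  isProbabilityMeasure_expMeasure (M.totalRate_pos s a)

/-- Joint law of the time until the next epoch (exponential) and of the state at that epoch. -/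
noncomputable def transition : Kernel (State × Action) (ℝ × State) :=
  Kernel.ofFunOfCountable fun p => (expMeasure (M.totalRate p.1 p.2)).prod (M.nextState p.1 p.2)

instance : IsMarkovKernel M.transition :=
  ⟨fun p => by
    change IsProbabilityMeasure
      ((expMeasure (M.totalRate p.1 p.2)).prod (M.nextState p.1 p.2))
    infer_instance⟩

/-- The record with index `n + 1` holds the action taken at epoch `n`, the time elapsed between
epochs `n` and `n + 1`, and the state at epoch `n + 1`. The record with index `0` holds the
initial state (and dummy entries). -/
abbrev Record : Type := Action × (ℝ × State)

/-- What is known when the decision at epoch `n` is made. -/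
abbrev History (n : ℕ) : Type := (_ : Finset.Iic n) → Record

/-- State at the current epoch. -/
def currentState {n : ℕ} (r : History n) : State := (r ⟨n, Finset.mem_Iic.2 le_rfl⟩).2.2

theorem measurable_currentState {n : ℕ} : Measurable (currentState (n := n)) := by
  unfold currentState
  fun_prop

/-- History-dependent (randomized) policies that only use actions of the action sets `A`. -/
structure Policy (A : State → Set Action) where
  choose : ∀ n, Kernel (History n) Action
  markov : ∀ n, IsMarkovKernel (choose n)
  feasible : ∀ n (r : History n), choose n r (A (currentState r))ᶜ = 0

variable {A : State → Set Action}

instance (π : Policy A) (n : ℕ) : IsMarkovKernel (π.choose n) := π.markov n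

/-- One step of the controlled process: the action is drawn from the policy, and then the time
until the next epoch and the state there from the transition law. -/
noncomputable def step (π : Policy A) (n : ℕ) : Kernel (History n) Record :=
  (π.choose n) ⊗ₖ
    (M.transition.comap (fun p : History n × Action => (currentState p.1, p.2))
      ((measurable_currentState.comp measurable_fst).prodMk measurable_snd))

instance (π : Policy A) (n : ℕ) : IsMarkovKernel (M.step π n) := by
  unfold step
  infer_instance

/-- Law of the controlled process under the policy `π` from the initial state `s`. -/
noncomputable def pathLaw (π : Policy A) (s : State) : Measure (ℕ → Record) :=
  Kernel.traj (X := fun _ => Record) (M.step π) 0 (fun _ => ((false, false), ((0 : ℝ), s)))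

/-- State at epoch `n`. -/
def stateAt (ω : ℕ → Record) (n : ℕ) : State := (ω n).2.2

/-- Action taken at epoch `n`. -/
def actionAt (ω : ℕ → Record) (n : ℕ) : Action := (ω (n + 1)).1

/-- Time of epoch `n`. -/
def timeAt (ω : ℕ → Record) (n : ℕ) : ℝ := ∑ k ∈ Finset.range n, (ω (k + 1)).2.1

/-- Total discounted reward: `R` at each epoch at which a customer is admitted. -/
noncomputable def reward (ω : ℕ → Record) : ENNReal :=
  ∑' n, if admitted (stateAt ω n) (actionAt ω n) = true then
    ENNReal.ofReal (Real.exp (-M.beta * timeAt ω n) * M.R) else 0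

/-- Cost rate after the decision: holding cost plus cost of the service rate. -/
noncomputable def costRate (s : State) (a : Action) : ℝ :=
  M.h (queueAfter s a) + if a.2 then M.c else 0

/-- Total discounted cost; the cost rate is constant between consecutive epochs. -/
noncomputable def cost (ω : ℕ → Record) : ENNReal :=
  ∑' n, ∫⁻ t in Set.Ico (timeAt ω n) (timeAt ω (n + 1)),
    ENNReal.ofReal (Real.exp (-M.beta * t) * M.costRate (stateAt ω n) (actionAt ω n))

/-- Expected discounted net profit of the policy `π` from the initial state `s`. -/
noncomputable def policyValue (π : Policy A) (s : State) : EReal :=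
  ((∫⁻ ω, M.reward ω ∂(M.pathLaw π s) : ENNReal) : EReal)
    - ((∫⁻ ω, M.cost ω ∂(M.pathLaw π s) : ENNReal) : EReal)

/-- Optimal expected discounted net profit over the policies with action sets `A`. -/
noncomputable def optimalValue (A : State → Set Action) (s : State) : EReal :=
  ⨆ π : Policy A, M.policyValue π s

/-- Value function `υ` of the joint problem. -/
noncomputable def value (s : State) : EReal := M.optimalValue jointActions s

/-- Value function `υ̂` of the admission control subproblem. -/
noncomputable def valueHat (s : State) : EReal := M.optimalValue admissionActions s

/-- Value `ε̂` of service flexibility. -/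
noncomputable def flexibility (s : State) : EReal := M.value s - M.valueHat s

/-- Burden `Δ(x, 0)` of an additional customer in the joint problem. -/
noncomputable def burden (x : ℕ) : EReal := M.value (x, false) - M.value (x + 1, false)

/-- Burden of an additional customer in the admission control subproblem. -/
noncomputable def burdenHat (x : ℕ) : EReal := M.valueHat (x, false) - M.valueHat (x + 1, false)

/-- `sup {k ≥ 0 : f k ≤ θ}`, which is `-1` if there is no such `k` and `⊤` if these `k` are
unbounded. -/
noncomputable def threshold (f : ℕ → EReal) (θ : ℝ) : EReal :=
  sSup (insert (-1) ((fun k : ℕ => (k : EReal)) '' {k | f k ≤ (θ : EReal)}))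

/-- Optimal service threshold `B^s` of the joint problem. -/
noncomputable def serviceThreshold : EReal := 1 + threshold M.burden (M.c / M.delta)

/-- Optimal admission threshold `B^d` of the joint problem. -/
noncomputable def admissionThreshold : EReal := threshold M.burden M.R

/-- Optimal admission threshold of the admission control subproblem. -/
noncomputable def admissionThresholdHat : EReal := threshold M.burdenHat M.R

/-- The growth conditions on the holding cost. -/
def HoldingCostGrowth : Prop :=
  (∃ θ : ℝ, 1 < θ ∧ ∀ x : ℕ, 0 < x → M.h (x + 1) ≤ θ * M.h x) ∧
  ∃ α : ℝ, 0 ≤ α ∧ α < 1 ∧ ∃ J : ℕ, 0 < J ∧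
    ∀ x : ℕ, M.Lam ^ J * (M.R + M.c + M.h (x + J)) ≤ α * (M.R + M.c + M.h x)

end QueueModel

/-! After uniformization (`lam + muh + beta = 1`) both problems satisfy the same Bellman equation;
only the gain `g` of the server differs: `jointGain` for the joint problem, with solution `v`, and
`lowGain` for the subproblem, with solution `w`. Value iteration from above gives solutions with
increasing burden (`exists_bellman_fixedPoint`), and a verification argument (`policyValue_le`,
`le_optimalValue`) identifies them with the suprema over all history-dependent policies.

Let G be the set of queue lengths x at which the low rate is optimal, i.e. v(x-1) - v(x) ≤ c/δ. The
hypothesis on the thresholds says that an admission that is optimal for `v` leads into G. Departures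
stay in G because burdens increase. So the joint optimal policy started in G stays there and uses
only the low rate: it is feasible for the subproblem, and w = v on G. Formally, the function equal
to `v` on G and `w` elsewhere satisfies V ≤ `actionValue` for some low-rate action in every state,
so it lies below `valueHat`.

For the admission thresholds, a k with burden at most R has both k and k+1 in G, so the two burdens
agree. Conversely, the first j whose burden exceeds R is in G, so w(j) = v(j), while w(j+1) ≤
v(j+1); hence the burden of `w` also exceeds R at j, and everywhere beyond by monotonicity. -/

namespace QueueModel

/-! ### Uniformized Bellman equation and its concave solution -/

/-- Value at an arrival epoch, in terms of the values `v` at the other epochs. -/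
noncomputable def admitValue (M : QueueModel) (v : ℕ → ℝ) (x : ℕ) : ℝ := max (M.R + v (x + 1)) (v x)

/-- Uniformized Bellman operator, where `g d` is the best net gain rate of the server when the
completion of a service is worth `d`. -/
noncomputable def bellman (M : QueueModel) (g : ℝ → ℝ) (v : ℕ → ℝ) (x : ℕ) : ℝ :=
  -M.h x + M.lam * M.admitValue v x + M.muh * v x + g (v (x - 1) - v x)

/-- The properties of the net gain rate of the server on which the structural results depend. -/
structure IsServiceGain (M : QueueModel) (g : ℝ → ℝ) : Prop where
  zero : g 0 = 0
  mono : Monotone g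
  mono_sub : Monotone fun d => M.muh * d - g d
  cont : Continuous g

/-- `v` is nonincreasing and concave. -/
def HasIncreasingBurden (v : ℕ → ℝ) : Prop := ∀ k, v (k - 1) - v k ≤ v k - v (k + 1)

theorem h_nonneg (M : QueueModel) (x : ℕ) : 0 ≤ M.h x := by
  have := M.h_mono (Nat.zero_le x)
  rwa [M.h_zero] at this

theorem muh_pos (M : QueueModel) : 0 < M.muh := M.mul_pos.trans M.mul_lt_muh

theorem admitValue_mono (M : QueueModel) {v w : ℕ → ℝ} (h : ∀ x, v x ≤ w x) (x : ℕ) :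
    M.admitValue v x ≤ M.admitValue w x :=
  max_le_max (add_le_add_right (h _) _) (h _)

/-- With d = v(x-1) - v(x), the service part is μ_h v(x-1) - (μ_h d - g d), so `mono_sub` gives
monotonicity in v(x); monotonicity of g gives it in v(x-1). -/
theorem bellman_mono (M : QueueModel) {g : ℝ → ℝ} (hg : M.IsServiceGain g) {v w : ℕ → ℝ}
    (h : ∀ x, v x ≤ w x) (x : ℕ) : M.bellman g v x ≤ M.bellman g w x := by
  have h1 := mul_le_mul_of_nonneg_left (M.admitValue_mono h x) M.lam_pos.le
  have h2 : M.muh * v x + g (v (x - 1) - v x) ≤ M.muh * w x + g (v (x - 1) - w x) := by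
    have := hg.mono_sub (show v (x - 1) - w x ≤ v (x - 1) - v x by linarith [h x])
    simp only at this
    nlinarith
  have h3 : g (v (x - 1) - w x) ≤ g (w (x - 1) - w x) := hg.mono (by linarith [h (x - 1)])
  unfold bellman
  linarith

/-- The constant is the profit if every arrival pays R and nothing costs anything; it starts the
decreasing iteration. -/
theorem bellman_const_le (M : QueueModel) {g : ℝ → ℝ} (hg : M.IsServiceGain g) (x : ℕ) :
    M.bellman g (fun _ => M.lam * M.R / M.beta) x ≤ M.lam * M.R / M.beta := by
  have h1 : M.beta * (M.lam * M.R / M.beta) = M.lam * M.R := mul_div_cancel₀ _ M.beta_pos.ne'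
  have h2 := M.h_nonneg x
  have h3 := M.normalized
  have h4 := M.R_nonneg
  unfold bellman admitValue
  rw [sub_self, hg.zero, max_eq_left (by linarith)]
  generalize M.lam * M.R / M.beta = K at *
  beta_reduce
  have h6 : (M.lam + M.muh + M.beta) * K = K := by rw [h3, one_mul]
  linarith

/-- Rejecting everybody at the low rate never lets the holding cost rate exceed h(x), hence this
lower bound for the iteration. -/
theorem le_bellman_holding (M : QueueModel) {g : ℝ → ℝ} (hg : M.IsServiceGain g) (x : ℕ) :
    -(M.h x / M.beta) ≤ M.bellman g (fun x => -(M.h x / M.beta)) x := by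
  have h1 : M.beta * (M.h x / M.beta) = M.h x := mul_div_cancel₀ _ M.beta_pos.ne'
  have h3 := M.normalized
  have h4 : M.h (x - 1) / M.beta ≤ M.h x / M.beta :=
    div_le_div_of_nonneg_right (M.h_mono (Nat.sub_le x 1)) M.beta_pos.le
  have h5 := hg.mono (show 0 ≤ -(M.h (x - 1) / M.beta) - -(M.h x / M.beta) by linarith)
  rw [hg.zero] at h5
  have h6 : -(M.h x / M.beta) ≤ M.admitValue (fun x => -(M.h x / M.beta)) x := le_max_right _ _
  have h7 := mul_le_mul_of_nonneg_left h6 M.lam_pos.le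
  unfold bellman
  beta_reduce
  generalize M.admitValue (fun x => -(M.h x / M.beta)) x = a at *
  generalize M.h x / M.beta = K at *
  have h8 : (M.lam + M.muh + M.beta) * K = K := by rw [h3, one_mul]
  linarith

/-- Each burden of the image is an increment of h plus nondecreasing functions of neighbouring
burdens of `v`: the admission term is `hm`, the service terms use `mono_sub` and `mono`. -/
theorem HasIncreasingBurden.bellman {M : QueueModel} {g : ℝ → ℝ} (hg : M.IsServiceGain g)
    {v : ℕ → ℝ} (hv : HasIncreasingBurden v) : HasIncreasingBurden (M.bellman g v) := by
  have hm : ∀ k, M.admitValue v k - M.admitValue v (k + 1)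
      = max M.R (v k - v (k + 1)) + min (v (k + 1) - v (k + 2) - M.R) 0 := by
    intro k
    unfold admitValue
    rcases le_total (M.R + v (k + 1)) (v k) with h1 | h1 <;>
    rcases le_total (M.R + v (k + 1 + 1)) (v (k + 1)) with h2 | h2
    · rw [max_eq_right h1, max_eq_right h2, max_eq_right (by linarith), min_eq_right (by linarith)]
      ring
    · rw [max_eq_right h1, max_eq_left h2, max_eq_right (by linarith), min_eq_left (by linarith)]
      ring
    · rw [max_eq_left h1, max_eq_right h2, max_eq_left (by linarith), min_eq_right (by linarith)]
      ring
    · rw [max_eq_left h1, max_eq_left h2, max_eq_left (by linarith), min_eq_left (by linarith)]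
      ring
  have hd : ∀ k, M.bellman g v k - M.bellman g v (k + 1) = (M.h (k + 1) - M.h k)
      + M.lam * (M.admitValue v k - M.admitValue v (k + 1))
      + (M.muh * (v k - v (k + 1)) - g (v k - v (k + 1))) + g (v (k - 1) - v k) := by
    intro k
    unfold QueueModel.bellman
    rw [Nat.add_sub_cancel]
    ring
  have hmono : ∀ k, M.admitValue v k - M.admitValue v (k + 1)
      ≤ M.admitValue v (k + 1) - M.admitValue v (k + 2) := by
    intro k
    rw [hm, hm]
    exact add_le_add (max_le_max le_rfl (hv (k + 1)))
      (min_le_min (sub_le_sub_right (hv (k + 2)) _) le_rfl)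
  intro k
  -- At k = 0 truncated subtraction makes the left side 0, so the claim is that the first burden is
  -- nonnegative.
  rcases k with _ | k
  · rw [hd]
    have h0 : (0 : ℝ) ≤ v 0 - v 1 := by simpa using hv 0
    have h1 : (0 : ℝ) ≤ v 1 - v 2 := h0.trans (hv 1)
    have h2 := M.h_mono (Nat.zero_le 1)
    have h3 : 0 ≤ M.admitValue v 0 - M.admitValue v 1 := by
      rw [hm]
      rcases le_total (v 1 - v 2 - M.R) 0 with h | h
      · rw [min_eq_left h]
        linarith [le_max_left M.R (v 0 - v (0 + 1))]
      · rw [min_eq_right h]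
        linarith [le_max_right M.R (v 0 - v (0 + 1)), M.R_nonneg, le_max_left M.R (v 0 - v (0 + 1))]
    have h4 := hg.mono_sub h0
    simp only [mul_zero, hg.zero, sub_zero] at h4
    have h5 := mul_nonneg M.lam_pos.le h3
    simp only [Nat.zero_sub, sub_self, hg.zero, zero_add]
    linarith
  · rw [Nat.add_sub_cancel, hd, hd, Nat.add_sub_cancel]
    have h1 := M.h_convex k
    have h2 := mul_le_mul_of_nonneg_left (hmono k) M.lam_pos.le
    have h3 := hg.mono_sub (hv (k + 1))
    have h4 := hg.mono (hv k)
    simp only [Nat.add_sub_cancel] at h3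
    linarith

open Filter Topology in
/-- The Bellman equation has a concave solution, obtained by value iteration from above. -/
theorem exists_bellman_fixedPoint (M : QueueModel) {g : ℝ → ℝ} (hg : M.IsServiceGain g) :
    ∃ v : ℕ → ℝ, (∀ x, v x ≤ M.lam * M.R / M.beta) ∧ (∀ x, -(M.h x / M.beta) ≤ v x) ∧
      (∀ x, M.bellman g v x = v x) ∧ HasIncreasingBurden v := by
  set u : ℕ → ℕ → ℝ := fun n => (M.bellman g)^[n] (fun _ => M.lam * M.R / M.beta) with hu
  have hs : ∀ n, u (n + 1) = M.bellman g (u n) := fun n => Function.iterate_succ_apply' _ _ _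
  have hanti : ∀ n x, u (n + 1) x ≤ u n x := by
    intro n
    induction n with
    | zero =>
      intro x
      exact M.bellman_const_le hg x
    | succ n ih =>
      intro x
      rw [hs (n + 1)]
      nth_rewrite 2 [hs n]
      exact M.bellman_mono hg ih x
  have hlow : ∀ n x, -(M.h x / M.beta) ≤ u n x := by
    intro n
    induction n with
    | zero =>
      intro x
      have h1 := div_nonneg (M.h_nonneg x) M.beta_pos.le
      have h2 := div_nonneg (mul_nonneg M.lam_pos.le M.R_nonneg) M.beta_pos.le
      change _ ≤ M.lam * M.R / M.beta
      linarith
    | succ n ih =>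
      intro x
      rw [hs]
      exact (M.le_bellman_holding hg x).trans (M.bellman_mono hg ih x)
  have hinc : ∀ n, HasIncreasingBurden (u n) := by
    intro n
    induction n with
    | zero =>
      intro k
      change M.lam * M.R / M.beta - M.lam * M.R / M.beta
        ≤ M.lam * M.R / M.beta - M.lam * M.R / M.beta
      exact le_rfl
    | succ n ih =>
      rw [hs]
      exact ih.bellman hg
  have hbdd : ∀ x, BddBelow (Set.range fun n => u n x) := by
    intro x
    refine ⟨-(M.h x / M.beta), ?_⟩
    rintro _ ⟨n, rfl⟩
    exact hlow n x
  have ht : ∀ x, Tendsto (fun n => u n x) atTop (𝓝 (⨅ n, u n x)) := fun x =>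
    tendsto_atTop_ciInf (antitone_nat_of_succ_le fun n => hanti n x) (hbdd x)
  refine ⟨fun x => ⨅ n, u n x, fun x => ciInf_le (hbdd x) 0, fun x => le_ciInf fun n => hlow n x,
    fun x => ?_, fun k => ?_⟩
  -- The operator at x sees only x-1, x and x+1, so pointwise convergence and continuity of g
  -- suffice.
  · have h1 : Tendsto (fun n => M.bellman g (u n) x) atTop
        (𝓝 (M.bellman g (fun x => ⨅ n, u n x) x)) := by
      unfold bellman admitValue
      exact ((tendsto_const_nhds.add (((tendsto_const_nhds.add (ht (x + 1))).max
        (ht x)).const_mul _)).add ((ht x).const_mul _)).add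
          ((hg.cont.tendsto _).comp ((ht (x - 1)).sub (ht x)))
    have h2 : Tendsto (fun n => M.bellman g (u n) x) atTop (𝓝 (⨅ n, u n x)) := by
      simp_rw [← hs]
      exact (ht x).comp (tendsto_add_atTop_nat 1)
    exact tendsto_nhds_unique h1 h2
  · exact le_of_tendsto_of_tendsto' ((ht _).sub (ht _)) ((ht _).sub (ht _)) fun n => hinc n k

end QueueModel

/-! ### Discounted integrals over exponential times -/

theorem lintegral_exp_neg_mul_expMeasure {b r : ℝ} (hb : 0 < b) (hr : 0 < r) :
    ∫⁻ t, ENNReal.ofReal (Real.exp (-b * t)) ∂expMeasure r = ENNReal.ofReal (r / (r + b)) := by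
  have h : ∀ t, exponentialPDF r t * ENNReal.ofReal (Real.exp (-b * t))
      = ENNReal.ofReal (r / (r + b)) * exponentialPDF (r + b) t := by
    intro t
    rcases lt_or_ge t 0 with ht | ht
    · rw [exponentialPDF_of_neg ht, exponentialPDF_of_neg ht, zero_mul, mul_zero]
    · rw [exponentialPDF_of_nonneg ht, exponentialPDF_of_nonneg ht,
        ← ENNReal.ofReal_mul (by positivity), ← ENNReal.ofReal_mul (by positivity)]
      congr 1
      rw [show -((r + b) * t) = -(r * t) + -b * t by ring, Real.exp_add]
      field_simp
  have hmeas : Measurable (exponentialPDF r) := (measurable_exponentialPDFReal r).ennreal_ofReal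
  have hmeas2 : Measurable (exponentialPDF (r + b)) :=
    (measurable_exponentialPDFReal (r + b)).ennreal_ofReal
  change ∫⁻ t, ENNReal.ofReal (Real.exp (-b * t)) ∂(volume.withDensity (exponentialPDF r)) = _
  rw [lintegral_withDensity_eq_lintegral_mul _ hmeas (by fun_prop)]
  simp only [Pi.mul_apply, h]
  rw [lintegral_const_mul _ hmeas2, lintegral_exponentialPDF_eq_one (by linarith), mul_one]

/-- Adding 1/b times the Laplace transform gives the constant 1/b, from which that finite term is
cancelled. -/
theorem lintegral_one_sub_exp_neg_mul_expMeasure {b r : ℝ} (hb : 0 < b) (hr : 0 < r) :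
    ∫⁻ t, ENNReal.ofReal ((1 - Real.exp (-b * t)) / b) ∂expMeasure r
      = ENNReal.ofReal (1 / (r + b)) := by
  have h : ∀ t, exponentialPDF r t * (ENNReal.ofReal ((1 - Real.exp (-b * t)) / b)
        + ENNReal.ofReal (1 / b) * ENNReal.ofReal (Real.exp (-b * t)))
      = ENNReal.ofReal (1 / b) * exponentialPDF r t := by
    intro t
    rcases lt_or_ge t 0 with ht | ht
    · rw [exponentialPDF_of_neg ht, zero_mul, mul_zero]
    · have h1 : Real.exp (-b * t) ≤ 1 := Real.exp_le_one_iff.2 (by nlinarith)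
      rw [← ENNReal.ofReal_mul (by positivity),
        ← ENNReal.ofReal_add (div_nonneg (by linarith) hb.le) (by positivity), mul_comm]
      congr 2
      ring
  have hmeas : Measurable (exponentialPDF r) := (measurable_exponentialPDFReal r).ennreal_ofReal
  have hsum : ∫⁻ t, ENNReal.ofReal ((1 - Real.exp (-b * t)) / b)
      + ENNReal.ofReal (1 / b) * ENNReal.ofReal (Real.exp (-b * t)) ∂expMeasure r
      = ENNReal.ofReal (1 / b) := by
    change ∫⁻ t, _ ∂(volume.withDensity (exponentialPDF r)) = _
    rw [lintegral_withDensity_eq_lintegral_mul _ hmeas (by fun_prop)]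
    simp only [Pi.mul_apply, h]
    rw [lintegral_const_mul _ hmeas, lintegral_exponentialPDF_eq_one hr, mul_one]
  rw [lintegral_add_left (by fun_prop), lintegral_const_mul _ (by fun_prop),
    lintegral_exp_neg_mul_expMeasure hb hr, ← ENNReal.ofReal_mul (by positivity)] at hsum
  have h2 : ENNReal.ofReal (1 / b)
      = ENNReal.ofReal (1 / (r + b)) + ENNReal.ofReal (1 / b * (r / (r + b))) := by
    rw [← ENNReal.ofReal_add (by positivity) (by positivity)]
    congr 1
    field_simp
    ring
  rw [h2] at hsum
  exact (ENNReal.add_left_inj ENNReal.ofReal_ne_top).1 hsum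

/-- For τ ≤ 0 both sides vanish, the right one by truncation in `ENNReal.ofReal`, so no almost sure
positivity of the sojourn times is needed. -/
theorem setLIntegral_Ico_exp_neg_mul {b k : ℝ} (hb : 0 < b) (hk : 0 ≤ k) (a τ : ℝ) :
    ∫⁻ t in Set.Ico a (a + τ), ENNReal.ofReal (Real.exp (-b * t) * k)
      = ENNReal.ofReal (Real.exp (-b * a)) *
        (ENNReal.ofReal ((1 - Real.exp (-b * τ)) / b) * ENNReal.ofReal k) := by
  rcases le_or_gt τ 0 with hτ | hτ
  · have h1 : 1 ≤ Real.exp (-b * τ) := Real.one_le_exp (by nlinarith)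
    rw [Set.Ico_eq_empty (by linarith), Measure.restrict_empty, lintegral_zero_measure,
      ENNReal.ofReal_of_nonpos (div_nonpos_of_nonpos_of_nonneg (by linarith) hb.le), zero_mul,
      mul_zero]
  · have h1 : Real.exp (-b * τ) ≤ 1 := Real.exp_le_one_iff.2 (by nlinarith)
    have hcont : Continuous fun t => Real.exp (-b * t) * k := by fun_prop
    have hint : ∫ t in a..(a + τ), Real.exp (-b * t) * k
        = Real.exp (-b * a) * ((1 - Real.exp (-b * τ)) / b * k) := by
      rw [intervalIntegral.integral_eq_sub_of_hasDerivAt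
        (f := fun t => Real.exp (-b * t) * (-(k / b)))]
      · rw [mul_add, Real.exp_add]
        ring
      · intro t _
        have h2 : Real.exp (-b * t) * k = Real.exp (-b * t) * (-b * 1) * -(k / b) := by
          field_simp
        rw [h2]
        exact (((hasDerivAt_id t).const_mul (-b)).exp).mul_const (-(k / b))
      · exact hcont.intervalIntegrable _ _
    rw [← ofReal_integral_eq_lintegral_ofReal, integral_Ico_eq_integral_Ioc,
      ← intervalIntegral.integral_of_le (by linarith), hint,
      ENNReal.ofReal_mul (Real.exp_pos _).le,
      ENNReal.ofReal_mul (div_nonneg (by linarith) hb.le)]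
    · exact (hcont.integrableOn_Icc).mono_set Set.Ico_subset_Icc_self
    · exact Filter.Eventually.of_forall fun t => mul_nonneg (Real.exp_pos _).le hk

/-! ### Conditioning the path law on the history -/

namespace QueueModel

variable (M : QueueModel) {A : State → Set Action}

/-- The defining property of the Ionescu-Tulcea measure: given the history, the next record has law
`step`. -/
theorem lintegral_history_next (π : Policy A) (s : State) (n : ℕ)
    {F : History n × Record → ENNReal} (hF : Measurable F) :
    ∫⁻ ω, F (Preorder.frestrictLe n ω, ω (n + 1)) ∂M.pathLaw π s
      = ∫⁻ ω, ∫⁻ r, F (Preorder.frestrictLe n ω, r) ∂M.step π n (Preorder.frestrictLe n ω)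
          ∂M.pathLaw π s := by
  have hm : Measurable fun ω : ℕ → Record =>
      ((Preorder.frestrictLe n ω : History n), ω (n + 1)) :=
    (Preorder.measurable_frestrictLe (X := fun _ : ℕ => Record) n).prodMk (measurable_pi_apply _)
  have h := Kernel.partialTraj_compProd_eq_map_traj (X := fun _ => Record) (κ := M.step π)
    (Nat.zero_le n) (x₀ := fun _ => ((false, false), ((0 : ℝ), s)))
  rw [← lintegral_map hF hm, pathLaw, ← h, Measure.lintegral_compProd hF,
    ← Kernel.traj_map_frestrictLe_apply, lintegral_map _ (Preorder.measurable_frestrictLe n)]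
  exact hF.lintegral_kernel_prod_right'

theorem lintegral_step (π : Policy A) (n : ℕ) (r : History n) {G : Record → ENNReal}
    (hG : Measurable G) :
    ∫⁻ y, G y ∂M.step π n r
      = ∫⁻ a, ∫⁻ p, G (a, p) ∂M.transition (currentState r, a) ∂π.choose n r := by
  rw [step, Kernel.lintegral_compProd _ _ _ hG]
  rfl

theorem lintegral_transition_mul (s : State) (a : Action) {φ : ℝ → ENNReal} (hφ : Measurable φ)
    (ψ : State → ENNReal) :
    ∫⁻ p, φ p.1 * ψ p.2 ∂M.transition (s, a)
      = (∫⁻ t, φ t ∂expMeasure (M.totalRate s a)) *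
        (ENNReal.ofReal (M.lam / M.totalRate s a) * ψ (queueAfter s a, true)
          + ENNReal.ofReal (M.departureRate s a / M.totalRate s a) *
            ψ (queueAfter s a - 1, false)) := by
  change ∫⁻ p, φ p.1 * ψ p.2 ∂((expMeasure (M.totalRate s a)).prod (M.nextState s a)) = _
  rw [lintegral_prod_mul hφ.aemeasurable (measurable_of_countable ψ).aemeasurable, nextState,
    lintegral_add_measure, lintegral_smul_measure, lintegral_smul_measure, lintegral_dirac,
    lintegral_dirac]
  rfl

/-- Discount factor at epoch `n`. -/
noncomputable def discount (ω : ℕ → Record) (n : ℕ) : ENNReal :=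
  ENNReal.ofReal (Real.exp (-M.beta * timeAt ω n))

@[fun_prop]
theorem measurable_timeAt (n : ℕ) : Measurable fun ω => timeAt ω n := by
  unfold timeAt
  fun_prop

@[fun_prop]
theorem measurable_discount (n : ℕ) : Measurable fun ω => M.discount ω n := by
  unfold discount
  fun_prop

theorem measurable_stateAt (n : ℕ) : Measurable fun ω => stateAt ω n := by
  unfold stateAt
  fun_prop

theorem discount_succ (ω : ℕ → Record) (n : ℕ) : M.discount ω (n + 1)
    = M.discount ω n * ENNReal.ofReal (Real.exp (-M.beta * (ω (n + 1)).2.1)) := by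
  unfold discount timeAt
  rw [Finset.sum_range_succ, mul_add, Real.exp_add, ENNReal.ofReal_mul (Real.exp_pos _).le]

theorem lintegral_discount_mul_next (π : Policy A) (s : State) (n : ℕ)
    {Φ : State × Record → ENNReal} (hΦ : Measurable Φ) :
    ∫⁻ ω, M.discount ω n * Φ (stateAt ω n, ω (n + 1)) ∂M.pathLaw π s
      = ∫⁻ ω, M.discount ω n *
          ∫⁻ y, Φ (stateAt ω n, y) ∂M.step π n (Preorder.frestrictLe n ω) ∂M.pathLaw π s := by
  -- The discount factor depends only on the history, so it comes out of the conditional integral.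
  let E : History n → ENNReal := fun r => ENNReal.ofReal
    (Real.exp (-M.beta * ∑ k : Fin n, (r ⟨k + 1, Finset.mem_Iic.2 k.2⟩).2.1))
  have hE : Measurable E := by
    unfold E
    fun_prop
  have hED : ∀ ω : ℕ → Record, E (Preorder.frestrictLe n ω) = M.discount ω n := by
    intro ω
    unfold E discount timeAt
    rw [Finset.sum_range]
    rfl
  have hF : Measurable fun p : History n × Record => E p.1 * Φ (currentState p.1, p.2) :=
    (hE.comp measurable_fst).mul
      (hΦ.comp ((measurable_currentState.comp measurable_fst).prodMk measurable_snd))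
  have h := M.lintegral_history_next π s n hF
  simp only [hED] at h
  refine h.trans (lintegral_congr fun ω => ?_)
  rw [lintegral_const_mul]
  · rfl
  · exact hΦ.comp (measurable_const.prodMk measurable_id)

end QueueModel

/-! ### Telescoping and one-step inequalities without subtraction -/

-- Telescoping of the step inequality. It serves both directions of verification: (W, r, D, c) is (K
-- - V, reward, K, cost) for the upper bound and (K, cost, K - V, reward) for the lower one. Only W
-- has to vanish in the limit, as D is dropped from the smaller side.
open Filter Topology in
theorem add_tsum_le_of_step_le {W r D c : ℕ → ENNReal} (hD : ∀ n, D n ≠ ⊤)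
    (hstep : ∀ n, W n + (r n + D (n + 1)) ≤ D n + (c n + W (n + 1)))
    (hW : Tendsto W atTop (𝓝 0)) : W 0 + ∑' n, r n ≤ D 0 + ∑' n, c n := by
  have hsum : ∀ n, W 0 + ∑ k ∈ Finset.range n, r k + D n
      ≤ D 0 + ∑ k ∈ Finset.range n, c k + W n := by
    intro n
    induction n with
    | zero => simp [add_comm]
    | succ n ih =>
      rw [Finset.sum_range_succ, Finset.sum_range_succ]
      -- W n cannot be cancelled if it is infinite, but then the step inequality makes the right
      -- side at n + 1 infinite.
      by_cases hw : W n = ⊤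
      · have h := hstep n
        rw [hw, top_add, top_le_iff, ENNReal.add_eq_top] at h
        have h2 := h.resolve_left (hD n)
        calc _ ≤ (⊤ : ENNReal) := le_top
          _ = c n + W (n + 1) := h2.symm
          _ ≤ _ := by
            rw [← add_assoc, add_assoc (D 0 + _)]
            exact le_add_self
      · refine (ENNReal.add_le_add_iff_right (ENNReal.add_ne_top.2 ⟨hw, hD n⟩)).1 ?_
        calc _ = (W 0 + ∑ k ∈ Finset.range n, r k + D n) + (W n + (r n + D (n + 1))) := by ring
          _ ≤ (D 0 + ∑ k ∈ Finset.range n, c k + W n) + (D n + (c n + W (n + 1))) :=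
            add_le_add ih (hstep n)
          _ = _ := by ring
  refine le_of_tendsto_of_tendsto' (tendsto_const_nhds.add (ENNReal.tendsto_nat_tsum r))
    (?_ : Tendsto (fun n => D 0 + ∑' n, c n + W n) atTop _)
    fun n => le_self_add.trans ((hsum n).trans ?_)
  · simpa using (tendsto_const_nhds (x := D 0 + ∑' n, c n)).add hW
  · gcongr
    exact ENNReal.sum_le_tsum _

namespace QueueModel

variable (M : QueueModel) {A : State → Set Action}

theorem departureRate_le (s : State) (a : Action) : M.departureRate s a ≤ M.muh := by
  have h1 := M.muh_pos
  have h2 := M.mul_lt_muh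
  unfold departureRate
  split_ifs <;> linarith

theorem totalRate_add_le (s : State) (a : Action) : M.totalRate s a + M.beta ≤ 1 := by
  have h1 := M.departureRate_le s a
  have h2 := M.normalized
  unfold totalRate
  linarith

theorem h_le_costRate (s : State) (a : Action) : M.h s.1 ≤ M.costRate s a := by
  have h1 : M.h s.1 ≤ M.h (queueAfter s a) := by
    refine M.h_mono ?_
    unfold queueAfter
    split_ifs <;> omega
  have h2 : (0 : ℝ) ≤ if a.2 then M.c else 0 := by
    have := M.c_pos
    split_ifs <;> linarith
  unfold costRate
  linarith

theorem costRate_nonneg (s : State) (a : Action) : 0 ≤ M.costRate s a :=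
  (M.h_nonneg _).trans (M.h_le_costRate s a)

/-- Reward collected at a decision epoch. -/
noncomputable def stepReward (s : State) (a : Action) : ℝ := if admitted s a = true then M.R else 0

theorem stepReward_nonneg (s : State) (a : Action) : 0 ≤ M.stepReward s a := by
  have := M.R_nonneg
  unfold stepReward
  split_ifs <;> linarith

theorem stepReward_le (s : State) (a : Action) : M.stepReward s a ≤ M.R := by
  have := M.R_nonneg
  unfold stepReward
  split_ifs <;> linarith

/-- Expected net profit of the action `a` in the state `s` if `V` is the value at the next epoch. -/
noncomputable def actionValue (V : State → ℝ) (s : State) (a : Action) : ℝ :=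
  M.stepReward s a + (-M.costRate s a + M.lam * V (queueAfter s a, true)
    + M.departureRate s a * V (queueAfter s a - 1, false)) / (M.totalRate s a + M.beta)

/-- Discounted reward until the next epoch, and value `K` there. -/
noncomputable def stepGain (K : ℝ) (p : State × Record) : ENNReal :=
  ENNReal.ofReal (M.stepReward p.1 p.2.1)
    + ENNReal.ofReal K * ENNReal.ofReal (Real.exp (-M.beta * p.2.2.1))

/-- Discounted cost until the next epoch. -/
noncomputable def stepCost (p : State × Record) : ENNReal :=
  ENNReal.ofReal ((1 - Real.exp (-M.beta * p.2.2.1)) / M.beta)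
    * ENNReal.ofReal (M.costRate p.1 p.2.1)

/-- Discounted cost until the next epoch, and value `W` there. -/
noncomputable def stepLoss (W : State → ENNReal) (p : State × Record) : ENNReal :=
  M.stepCost p + ENNReal.ofReal (Real.exp (-M.beta * p.2.2.1)) * W p.2.2.2

theorem measurable_state_action {E : Type*} [MeasurableSpace E] (f : State → Action → E) :
    Measurable fun p : State × Record => f p.1 p.2.1 :=
  (measurable_of_countable (Function.uncurry f)).comp
    (measurable_fst.prodMk (measurable_fst.comp measurable_snd))

theorem measurable_record {E : Type*} [MeasurableSpace E] {Φ : State × Record → E}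
    (hΦ : Measurable Φ) (s : State) : Measurable fun y : Record => Φ (s, y) :=
  hΦ.comp measurable_prodMk_left

theorem measurable_stepGain (K : ℝ) : Measurable (M.stepGain K) :=
  (measurable_state_action fun s a => ENNReal.ofReal (M.stepReward s a)).add (by fun_prop)

theorem measurable_stepCost : Measurable M.stepCost :=
  Measurable.mul (by fun_prop) (measurable_state_action fun s a => ENNReal.ofReal (M.costRate s a))

theorem measurable_stepLoss (W : State → ENNReal) : Measurable (M.stepLoss W) :=
  M.measurable_stepCost.add (Measurable.mul (by fun_prop)
    ((measurable_of_countable W).comp (by fun_prop)))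

theorem lintegral_transition_fst (s : State) (a : Action) {φ : ℝ → ENNReal} (hφ : Measurable φ) :
    ∫⁻ p, φ p.1 ∂M.transition (s, a) = ∫⁻ t, φ t ∂expMeasure (M.totalRate s a) := by
  have h := M.lintegral_transition_mul s a hφ (fun _ => 1)
  have hpos := M.totalRate_pos s a
  simp only [mul_one] at h
  rw [h, ← ENNReal.ofReal_add (div_nonneg M.lam_pos.le hpos.le)
    (div_nonneg (M.departureRate_nonneg s a) hpos.le), ← add_div,
    show M.lam + M.departureRate s a = M.totalRate s a from rfl, div_self hpos.ne',
    ENNReal.ofReal_one, mul_one]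

theorem lintegral_transition_stepGain {K : ℝ} (hK : 0 ≤ K) (s : State) (a : Action) :
    ∫⁻ p, M.stepGain K (s, (a, p)) ∂M.transition (s, a) = ENNReal.ofReal (M.stepReward s a
      + K * (M.totalRate s a / (M.totalRate s a + M.beta))) := by
  have hpos := M.totalRate_pos s a
  have hb := M.beta_pos
  simp only [stepGain]
  rw [lintegral_add_left measurable_const, lintegral_const, measure_univ, mul_one,
    lintegral_const_mul _ (by fun_prop), M.lintegral_transition_fst s a
      (φ := fun t => ENNReal.ofReal (Real.exp (-M.beta * t))) (by fun_prop),
    lintegral_exp_neg_mul_expMeasure hb hpos, ← ENNReal.ofReal_mul hK,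
    ← ENNReal.ofReal_add (M.stepReward_nonneg s a) (by positivity)]

theorem lintegral_transition_stepCost (s : State) (a : Action) :
    ∫⁻ p, M.stepCost (s, (a, p)) ∂M.transition (s, a)
      = ENNReal.ofReal (M.costRate s a / (M.totalRate s a + M.beta)) := by
  have hpos := M.totalRate_pos s a
  have hb := M.beta_pos
  simp only [stepCost]
  rw [lintegral_mul_const _ (by fun_prop), M.lintegral_transition_fst s a
      (φ := fun t => ENNReal.ofReal ((1 - Real.exp (-M.beta * t)) / M.beta)) (by fun_prop),
    lintegral_one_sub_exp_neg_mul_expMeasure hb hpos, ← ENNReal.ofReal_mul (by positivity)]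
  congr 1
  ring

theorem lintegral_transition_stepLoss {K : ℝ} {V : State → ℝ} (hV : ∀ s, V s ≤ K) (s : State)
    (a : Action) :
    ∫⁻ p, M.stepLoss (fun s => ENNReal.ofReal (K - V s)) (s, (a, p)) ∂M.transition (s, a)
      = ENNReal.ofReal ((M.costRate s a + M.lam * (K - V (queueAfter s a, true))
        + M.departureRate s a * (K - V (queueAfter s a - 1, false)))
          / (M.totalRate s a + M.beta)) := by
  have hpos := M.totalRate_pos s a
  have hb := M.beta_pos
  have hl := M.lam_pos
  have hd := M.departureRate_nonneg s a
  have hc := M.costRate_nonneg s a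
  have hV1 := sub_nonneg.2 (hV (queueAfter s a, true))
  have hV2 := sub_nonneg.2 (hV (queueAfter s a - 1, false))
  have hm : Measurable fun p : ℝ × State => M.stepCost (s, (a, p)) :=
    M.measurable_stepCost.comp (by fun_prop)
  simp only [stepLoss]
  rw [lintegral_add_left hm, M.lintegral_transition_stepCost,
    M.lintegral_transition_mul s a
      (φ := fun t => ENNReal.ofReal (Real.exp (-M.beta * t))) (by fun_prop)
      (fun s => ENNReal.ofReal (K - V s)),
    lintegral_exp_neg_mul_expMeasure hb hpos, ← ENNReal.ofReal_mul (by positivity),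
    ← ENNReal.ofReal_mul (by positivity), ← ENNReal.ofReal_add (by positivity) (by positivity),
    ← ENNReal.ofReal_mul (by positivity), ← ENNReal.ofReal_add (by positivity) (by positivity)]
  congr 1
  field_simp
  ring

/-- The shift by K keeps all integrands nonnegative; it cancels because K is discounted equally in
gain and loss. -/
theorem stepGain_sub_stepLoss (K : ℝ) (V : State → ℝ) (s : State) (a : Action) :
    M.stepReward s a + K * (M.totalRate s a / (M.totalRate s a + M.beta))
      - (M.costRate s a + M.lam * (K - V (queueAfter s a, true))
        + M.departureRate s a * (K - V (queueAfter s a - 1, false)))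
          / (M.totalRate s a + M.beta) = M.actionValue V s a := by
  have hpos : M.totalRate s a + M.beta ≠ 0 := (add_pos (M.totalRate_pos s a) M.beta_pos).ne'
  unfold actionValue
  field_simp
  unfold totalRate
  ring

theorem stepGain_lintegral_nonneg {K : ℝ} (hK : 0 ≤ K) (s : State) (a : Action) :
    0 ≤ M.stepReward s a + K * (M.totalRate s a / (M.totalRate s a + M.beta)) := by
  have hpos := M.totalRate_pos s a
  have hb := M.beta_pos
  have := M.stepReward_nonneg s a
  positivity

theorem stepLoss_lintegral_nonneg {K : ℝ} {V : State → ℝ} (hV : ∀ s, V s ≤ K) (s : State)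
    (a : Action) : 0 ≤ (M.costRate s a + M.lam * (K - V (queueAfter s a, true))
        + M.departureRate s a * (K - V (queueAfter s a - 1, false)))
          / (M.totalRate s a + M.beta) := by
  have hpos := M.totalRate_pos s a
  have hb := M.beta_pos
  have hl := M.lam_pos
  have hd := M.departureRate_nonneg s a
  have hc := M.costRate_nonneg s a
  have hV1 := sub_nonneg.2 (hV (queueAfter s a, true))
  have hV2 := sub_nonneg.2 (hV (queueAfter s a - 1, false))
  positivity

/-- The Bellman inequality with its negative terms moved across, so that it can be integrated in
`ENNReal`. -/
theorem add_lintegral_stepGain_le {K : ℝ} (hK : 0 ≤ K) {V : State → ℝ} (hV : ∀ s, V s ≤ K)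
    (π : Policy A) (n : ℕ) (r : History n)
    (h : ∀ᵐ a ∂π.choose n r, M.actionValue V (currentState r) a ≤ V (currentState r)) :
    ENNReal.ofReal (K - V (currentState r)) + ∫⁻ y, M.stepGain K (currentState r, y) ∂M.step π n r
      ≤ ENNReal.ofReal K + ∫⁻ y, M.stepLoss (fun s => ENNReal.ofReal (K - V s))
        (currentState r, y) ∂M.step π n r := by
  rw [lintegral_step _ _ _ _ (measurable_record (M.measurable_stepGain K) _),
    lintegral_step _ _ _ _ (measurable_record (M.measurable_stepLoss _) _)]
  simp only [M.lintegral_transition_stepGain hK, M.lintegral_transition_stepLoss hV]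
  have hc : ∀ x : ENNReal, x = ∫⁻ _, x ∂π.choose n r := fun x => by simp
  rw [hc (ENNReal.ofReal (K - V (currentState r))), hc (ENNReal.ofReal K),
    ← lintegral_add_left measurable_const, ← lintegral_add_left measurable_const]
  refine lintegral_mono_ae (h.mono fun a ha => ?_)
  rw [← ENNReal.ofReal_add (sub_nonneg.2 (hV _)) (M.stepGain_lintegral_nonneg hK _ _),
    ← ENNReal.ofReal_add hK (M.stepLoss_lintegral_nonneg hV _ _)]
  refine ENNReal.ofReal_le_ofReal ?_
  rw [← M.stepGain_sub_stepLoss K] at ha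
  linarith

theorem add_lintegral_stepLoss_le {K : ℝ} (hK : 0 ≤ K) {V : State → ℝ} (hV : ∀ s, V s ≤ K)
    (π : Policy A) (n : ℕ) (r : History n)
    (h : ∀ᵐ a ∂π.choose n r, V (currentState r) ≤ M.actionValue V (currentState r) a) :
    ENNReal.ofReal K + ∫⁻ y, M.stepLoss (fun s => ENNReal.ofReal (K - V s))
        (currentState r, y) ∂M.step π n r
      ≤ ENNReal.ofReal (K - V (currentState r))
        + ∫⁻ y, M.stepGain K (currentState r, y) ∂M.step π n r := by
  rw [lintegral_step _ _ _ _ (measurable_record (M.measurable_stepGain K) _),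
    lintegral_step _ _ _ _ (measurable_record (M.measurable_stepLoss _) _)]
  simp only [M.lintegral_transition_stepGain hK, M.lintegral_transition_stepLoss hV]
  have hc : ∀ x : ENNReal, x = ∫⁻ _, x ∂π.choose n r := fun x => by simp
  rw [hc (ENNReal.ofReal (K - V (currentState r))), hc (ENNReal.ofReal K),
    ← lintegral_add_left measurable_const, ← lintegral_add_left measurable_const]
  refine lintegral_mono_ae (h.mono fun a ha => ?_)
  rw [← ENNReal.ofReal_add (sub_nonneg.2 (hV _)) (M.stepGain_lintegral_nonneg hK _ _),
    ← ENNReal.ofReal_add hK (M.stepLoss_lintegral_nonneg hV _ _)]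
  refine ENNReal.ofReal_le_ofReal ?_
  rw [← M.stepGain_sub_stepLoss K] at ha
  linarith

/-! ### Expectations along the path and verification -/

instance (π : Policy A) (s : State) : IsProbabilityMeasure (M.pathLaw π s) := by
  unfold pathLaw
  infer_instance

/-- Expected discounted value of `f` in the state at epoch `n`. -/
noncomputable def expState (π : Policy A) (s : State) (f : State → ENNReal) (n : ℕ) : ENNReal :=
  ∫⁻ ω, M.discount ω n * f (stateAt ω n) ∂M.pathLaw π s

/-- Expected discounted reward at epoch `n`. -/
noncomputable def expReward (π : Policy A) (s : State) (n : ℕ) : ENNReal :=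
  ∫⁻ ω, M.discount ω n * ENNReal.ofReal (M.stepReward (stateAt ω n) (actionAt ω n)) ∂M.pathLaw π s

/-- Expected discounted cost between the epochs `n` and `n + 1`. -/
noncomputable def expCost (π : Policy A) (s : State) (n : ℕ) : ENNReal :=
  ∫⁻ ω, M.discount ω n * M.stepCost (stateAt ω n, ω (n + 1)) ∂M.pathLaw π s

theorem measurable_comp_stateAt (f : State → ENNReal) (n : ℕ) :
    Measurable fun ω => f (stateAt ω n) :=
  (measurable_of_countable f).comp (measurable_stateAt n)

theorem measurable_stateAt_next {Φ : State × Record → ENNReal} (hΦ : Measurable Φ) (n : ℕ) :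
    Measurable fun ω : ℕ → Record => Φ (stateAt ω n, ω (n + 1)) :=
  hΦ.comp ((measurable_stateAt n).prodMk (measurable_pi_apply _))

theorem measurable_discount_mul_next {Φ : State × Record → ENNReal} (hΦ : Measurable Φ) (n : ℕ) :
    Measurable fun ω : ℕ → Record => M.discount ω n * Φ (stateAt ω n, ω (n + 1)) :=
  (M.measurable_discount n).mul (measurable_stateAt_next hΦ n)

theorem measurable_discount_mul_state (f : State → ENNReal) (n : ℕ) :
    Measurable fun ω : ℕ → Record => M.discount ω n * f (stateAt ω n) :=
  (M.measurable_discount n).mul (measurable_comp_stateAt f n)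

theorem measurable_discount_mul_stepReward (n : ℕ) : Measurable fun ω : ℕ → Record =>
    M.discount ω n * ENNReal.ofReal (M.stepReward (stateAt ω n) (actionAt ω n)) :=
  M.measurable_discount_mul_next
    (measurable_state_action fun s a => ENNReal.ofReal (M.stepReward s a)) n

theorem lintegral_reward (π : Policy A) (s : State) :
    ∫⁻ ω, M.reward ω ∂M.pathLaw π s = ∑' n, M.expReward π s n := by
  unfold expReward
  rw [← lintegral_tsum fun n => (M.measurable_discount_mul_stepReward n).aemeasurable]
  refine lintegral_congr fun ω => tsum_congr fun n => ?_
  unfold stepReward discount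
  split_ifs
  · exact ENNReal.ofReal_mul (Real.exp_pos _).le
  · simp

theorem lintegral_cost (π : Policy A) (s : State) :
    ∫⁻ ω, M.cost ω ∂M.pathLaw π s = ∑' n, M.expCost π s n := by
  unfold expCost
  rw [← lintegral_tsum fun n =>
    (M.measurable_discount_mul_next M.measurable_stepCost n).aemeasurable]
  refine lintegral_congr fun ω => tsum_congr fun n => ?_
  have h : timeAt ω (n + 1) = timeAt ω n + (ω (n + 1)).2.1 := Finset.sum_range_succ _ _
  rw [h, setLIntegral_Ico_exp_neg_mul M.beta_pos (M.costRate_nonneg _ _)]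
  rfl

theorem expState_zero (π : Policy A) (s : State) (f : State → ENNReal) :
    M.expState π s f 0 = f s := by
  have h := Kernel.traj_map_frestrictLe_apply (X := fun _ => Record) (κ := M.step π) 0 0
    (fun _ => ((false, false), ((0 : ℝ), s)))
  rw [Kernel.partialTraj_self, Kernel.id_apply] at h
  have hf : Measurable fun r : History 0 => f (currentState r) :=
    (measurable_of_countable f).comp measurable_currentState
  have h2 : ∫⁻ ω, f (stateAt ω 0) ∂M.pathLaw π s = f s := by
    have h3 := lintegral_map (μ := M.pathLaw π s) hf
      (Preorder.measurable_frestrictLe (X := fun _ : ℕ => Record) 0)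
    unfold pathLaw at h3 ⊢
    rw [h, lintegral_dirac' _ hf] at h3
    exact h3.symm
  unfold expState discount timeAt
  simpa using h2

theorem lintegral_discount_succ_mul (π : Policy A) (s : State) (f : State → ENNReal) (n : ℕ) :
    M.expState π s f (n + 1) = ∫⁻ ω, M.discount ω n *
      (ENNReal.ofReal (Real.exp (-M.beta * (ω (n + 1)).2.1)) * f (stateAt ω (n + 1)))
        ∂M.pathLaw π s := by
  unfold expState
  exact lintegral_congr fun ω => by rw [discount_succ, mul_assoc]

theorem lintegral_discount_stepGain (π : Policy A) (s : State) (K : ℝ) (n : ℕ) :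
    ∫⁻ ω, M.discount ω n * M.stepGain K (stateAt ω n, ω (n + 1)) ∂M.pathLaw π s
      = M.expReward π s n + M.expState π s (fun _ => ENNReal.ofReal K) (n + 1) := by
  rw [lintegral_discount_succ_mul, expReward, ← lintegral_add_left]
  · refine lintegral_congr fun ω => ?_
    rw [← mul_add, stepGain, mul_comm (ENNReal.ofReal K)]
    rfl
  · exact M.measurable_discount_mul_stepReward n

theorem lintegral_discount_stepLoss (π : Policy A) (s : State) (W : State → ENNReal) (n : ℕ) :
    ∫⁻ ω, M.discount ω n * M.stepLoss W (stateAt ω n, ω (n + 1)) ∂M.pathLaw π s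
      = M.expCost π s n + M.expState π s W (n + 1) := by
  rw [lintegral_discount_succ_mul, expCost, ← lintegral_add_left]
  · exact lintegral_congr fun ω => by rw [← mul_add]; rfl
  · exact M.measurable_discount_mul_next M.measurable_stepCost n

/-- A one-step inequality that holds conditionally on every history holds in expectation. -/
theorem expState_add_le (π : Policy A) (s : State) (n : ℕ) {Φ Ψ : State × Record → ENNReal}
    (hΦ : Measurable Φ) (hΨ : Measurable Ψ) (f g : State → ENNReal)
    (h : ∀ r : History n, f (currentState r) + ∫⁻ y, Φ (currentState r, y) ∂M.step π n r
      ≤ g (currentState r) + ∫⁻ y, Ψ (currentState r, y) ∂M.step π n r) :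
    M.expState π s f n + ∫⁻ ω, M.discount ω n * Φ (stateAt ω n, ω (n + 1)) ∂M.pathLaw π s
      ≤ M.expState π s g n
        + ∫⁻ ω, M.discount ω n * Ψ (stateAt ω n, ω (n + 1)) ∂M.pathLaw π s := by
  rw [M.lintegral_discount_mul_next π s n hΦ, M.lintegral_discount_mul_next π s n hΨ, expState,
    expState, ← lintegral_add_left, ← lintegral_add_left]
  · refine lintegral_mono fun ω => ?_
    simp only [← mul_add]
    exact mul_le_mul_right (h (Preorder.frestrictLe n ω)) _
  · exact M.measurable_discount_mul_state g n
  · exact M.measurable_discount_mul_state f n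

theorem Lam_lt_one : M.Lam < 1 := by
  have h1 := M.normalized
  have h2 := M.beta_pos
  unfold Lam
  linarith

theorem expState_const (π : Policy A) (s : State) (k : ENNReal) (n : ℕ) :
    M.expState π s (fun _ => k) n = k * M.expState π s (fun _ => 1) n := by
  unfold expState
  simp only [mul_one]
  rw [lintegral_mul_const _ (M.measurable_discount n), mul_comm]

/-- For total rate q the mean discount of a step is q/(q+β), at most 1 - β = Λ because q + β ≤ 1. -/
theorem expState_one_succ_le (π : Policy A) (s : State) (n : ℕ) :
    M.expState π s (fun _ => 1) (n + 1)
      ≤ ENNReal.ofReal M.Lam * M.expState π s (fun _ => 1) n := by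
  have hm : Measurable fun p : State × Record =>
      ENNReal.ofReal (Real.exp (-M.beta * p.2.2.1)) := by fun_prop
  have h := M.expState_add_le π s n hm (measurable_const (a := (0 : ENNReal))) (fun _ => 0)
    (fun _ => ENNReal.ofReal M.Lam) fun r => by
      rw [M.lintegral_step π n r
        (G := fun y => ENNReal.ofReal (Real.exp (-M.beta * y.2.1))) (by fun_prop)]
      simp only [lintegral_const, zero_add, zero_mul, add_zero]
      refine (lintegral_mono (g := fun _ => ENNReal.ofReal M.Lam) fun a => ?_).trans (by simp)
      have hpos := M.totalRate_pos (currentState r) a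
      have hb := M.beta_pos
      rw [M.lintegral_transition_fst _ _
        (φ := fun t => ENNReal.ofReal (Real.exp (-M.beta * t))) (by fun_prop),
        lintegral_exp_neg_mul_expMeasure hb hpos]
      refine ENNReal.ofReal_le_ofReal ((div_le_iff₀ (by linarith)).2 ?_)
      have h1 := M.totalRate_add_le (currentState r) a
      have h2 := M.normalized
      have h3 : M.Lam = 1 - M.beta := by
        unfold Lam
        linarith
      rw [h3]
      nlinarith
  simp only [mul_zero, lintegral_zero, add_zero] at h
  rw [expState_const M π s (ENNReal.ofReal M.Lam)] at h
  rw [lintegral_discount_succ_mul]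
  simp only [mul_one]
  exact le_add_self.trans h

theorem expState_one_le (π : Policy A) (s : State) (n : ℕ) :
    M.expState π s (fun _ => 1) n ≤ ENNReal.ofReal M.Lam ^ n := by
  induction n with
  | zero => rw [expState_zero, pow_zero]
  | succ n ih =>
    rw [pow_succ']
    exact (M.expState_one_succ_le π s n).trans (by gcongr)

open Filter Topology in
theorem tendsto_expState_const (π : Policy A) (s : State) {k : ENNReal} (hk : k ≠ ⊤) :
    Tendsto (M.expState π s fun _ => k) atTop (𝓝 0) := by
  have h1 : Tendsto (fun n => ENNReal.ofReal M.Lam ^ n) atTop (𝓝 0) :=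
    ENNReal.tendsto_pow_atTop_nhds_zero_of_lt_one
      (ENNReal.ofReal_lt_one.2 M.Lam_lt_one)
  have h2 := ENNReal.Tendsto.const_mul h1 (Or.inr hk)
  rw [mul_zero] at h2
  refine tendsto_of_tendsto_of_tendsto_of_le_of_le tendsto_const_nhds h2 (fun _ => zero_le)
    fun n => ?_
  dsimp only
  rw [expState_const]
  exact mul_le_mul_right (M.expState_one_le π s n) _

theorem expReward_le (π : Policy A) (s : State) (n : ℕ) :
    M.expReward π s n ≤ ENNReal.ofReal M.R * ENNReal.ofReal M.Lam ^ n := by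
  refine le_trans ?_ (mul_le_mul_right (M.expState_one_le π s n) _)
  rw [← expState_const]
  exact lintegral_mono fun ω =>
    mul_le_mul_right (ENNReal.ofReal_le_ofReal (M.stepReward_le _ _)) _

theorem tsum_expReward_ne_top (π : Policy A) (s : State) : ∑' n, M.expReward π s n ≠ ⊤ := by
  refine ne_top_of_le_ne_top ?_ (ENNReal.tsum_le_tsum (M.expReward_le π s))
  rw [ENNReal.tsum_mul_left, ENNReal.tsum_geometric]
  refine ENNReal.mul_ne_top ENNReal.ofReal_ne_top (ENNReal.inv_ne_top.2 ?_)
  exact (tsub_pos_of_lt (ENNReal.ofReal_lt_one.2 M.Lam_lt_one)).ne'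

/-- The mean discounted length 1/(q+β) of a step is at least 1, and the cost rate is at least the
holding cost before the decision. -/
theorem expState_h_le (π : Policy A) (s : State) (n : ℕ) :
    M.expState π s (fun s => ENNReal.ofReal (M.h s.1)) n ≤ M.expCost π s n := by
  have h := M.expState_add_le π s n (measurable_const (a := (0 : ENNReal))) M.measurable_stepCost
    (fun s => ENNReal.ofReal (M.h s.1)) (fun _ => 0) fun r => by
      rw [M.lintegral_step π n r (measurable_record M.measurable_stepCost _)]
      simp only [lintegral_const, zero_add, zero_mul, add_zero, M.lintegral_transition_stepCost]
      refine le_trans (by simp) (lintegral_mono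
        (f := fun _ => ENNReal.ofReal (M.h (currentState r).1)) fun a => ?_)
      have hpos := M.totalRate_pos (currentState r) a
      have hb := M.beta_pos
      have h1 := M.totalRate_add_le (currentState r) a
      have h2 := M.h_le_costRate (currentState r) a
      have h3 := M.costRate_nonneg (currentState r) a
      refine ENNReal.ofReal_le_ofReal ((le_div_iff₀ (by linarith)).2 ?_)
      nlinarith [M.h_nonneg (currentState r).1]
  simpa [expCost, expState] using h

-- V may be unbounded below, but K - V ≤ K + h/β, and the discounted expectation of h is dominated
-- by the terms of a convergent cost series.
open Filter Topology in
theorem tendsto_expState (π : Policy A) (s : State) (hc : ∑' n, M.expCost π s n ≠ ⊤) {K : ℝ}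
    (hK : 0 ≤ K) {V : State → ℝ} (hV : ∀ s, -(M.h s.1 / M.beta) ≤ V s) :
    Tendsto (M.expState π s fun s => ENNReal.ofReal (K - V s)) atTop (𝓝 0) := by
  have h1 := M.tendsto_expState_const π s (ENNReal.ofReal_ne_top (r := K))
  have h2 := ENNReal.Tendsto.const_mul (a := ENNReal.ofReal (1 / M.beta))
    (ENNReal.tendsto_atTop_zero_of_tsum_ne_top hc) (Or.inr ENNReal.ofReal_ne_top)
  have h3 := h1.add h2
  rw [mul_zero, add_zero] at h3
  refine tendsto_of_tendsto_of_tendsto_of_le_of_le tendsto_const_nhds h3 (fun _ => zero_le)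
    fun n => ?_
  have hb := M.beta_pos
  refine le_trans ?_ (add_le_add_right (mul_le_mul_right (M.expState_h_le π s n) _) _)
  unfold expState
  rw [← lintegral_const_mul _
      (M.measurable_discount_mul_state (fun s => ENNReal.ofReal (M.h s.1)) n),
    ← lintegral_add_left (M.measurable_discount_mul_state (fun _ => ENNReal.ofReal K) n)]
  refine lintegral_mono fun ω => ?_
  dsimp only
  rw [mul_left_comm, ← mul_add]
  refine mul_le_mul_right ?_ _
  rw [← ENNReal.ofReal_mul (by positivity),
    ← ENNReal.ofReal_add hK (mul_nonneg (by positivity) (M.h_nonneg _))]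
  refine ENNReal.ofReal_le_ofReal ?_
  have := hV (stateAt ω n)
  rw [one_div, inv_mul_eq_div]
  linarith

theorem policyValue_eq (π : Policy A) (s : State) : M.policyValue π s
    = ((∑' n, M.expReward π s n : ENNReal) : EReal) - ((∑' n, M.expCost π s n : ENNReal) : EReal) := by
  rw [policyValue, lintegral_reward, lintegral_cost]

/-- A solution of the Bellman inequality is an upper bound of the values of all policies. -/
theorem policyValue_le {K : ℝ} (hK : 0 ≤ K) {V : State → ℝ} (hV : ∀ s, V s ≤ K)
    (hlow : ∀ s, -(M.h s.1 / M.beta) ≤ V s)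
    (hbell : ∀ s, ∀ a ∈ A s, M.actionValue V s a ≤ V s) (π : Policy A) (s : State) :
    M.policyValue π s ≤ V s := by
  rw [policyValue_eq]
  -- With infinite cost the value is `⊥`.
  by_cases hc : ∑' n, M.expCost π s n = ⊤
  · simp [hc]
  have h := add_tsum_le_of_step_le
    (W := M.expState π s fun s => ENNReal.ofReal (K - V s)) (r := M.expReward π s)
    (D := M.expState π s fun _ => ENNReal.ofReal K) (c := M.expCost π s)
    (fun n => by
      rw [expState_const]
      exact ENNReal.mul_ne_top ENNReal.ofReal_ne_top (ne_top_of_le_ne_top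
        (ENNReal.pow_ne_top ENNReal.ofReal_ne_top) (M.expState_one_le π s n)))
    (fun n => by
      have := M.expState_add_le π s n (M.measurable_stepGain K)
        (M.measurable_stepLoss fun s => ENNReal.ofReal (K - V s))
        (fun s => ENNReal.ofReal (K - V s)) (fun _ => ENNReal.ofReal K) fun r =>
          M.add_lintegral_stepGain_le hK hV π n r
            ((show ∀ᵐ a ∂π.choose n r, a ∈ A (currentState r) from π.feasible n r).mono
              fun a ha => hbell _ a ha)
      rwa [lintegral_discount_stepGain, lintegral_discount_stepLoss] at this)
    (M.tendsto_expState π s hc hK hlow)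
  rw [expState_zero, expState_zero] at h
  have hr := M.tsum_expReward_ne_top π s
  generalize ∑' n, M.expReward π s n = x at *
  generalize ∑' n, M.expCost π s n = y at *
  lift x to NNReal using hr
  lift y to NNReal using hc
  rw [← ENNReal.ofReal_coe_nnreal (p := x), ← ENNReal.ofReal_coe_nnreal (p := y),
    ← ENNReal.ofReal_add (sub_nonneg.2 (hV s)) x.coe_nonneg, ← ENNReal.ofReal_add hK y.coe_nonneg,
    ENNReal.ofReal_le_ofReal_iff (add_nonneg hK y.coe_nonneg)] at h
  change ((x : ℝ) : EReal) - ((y : ℝ) : EReal) ≤ _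
  rw [← EReal.coe_sub, EReal.coe_le_coe_iff]
  linarith

/-- A policy whose actions all satisfy the reverse Bellman inequality is at least as good. -/
theorem le_policyValue {K : ℝ} (hK : 0 ≤ K) {V : State → ℝ} (hV : ∀ s, V s ≤ K) (π : Policy A)
    (hbell : ∀ n (r : History n), ∀ᵐ a ∂π.choose n r,
      V (currentState r) ≤ M.actionValue V (currentState r) a) (s : State) :
    (V s : EReal) ≤ M.policyValue π s := by
  rw [policyValue_eq]
  have hr := M.tsum_expReward_ne_top π s
  have hstep : ∀ n, M.expState π s (fun _ => ENNReal.ofReal K) n + (M.expCost π s n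
      + M.expState π s (fun s => ENNReal.ofReal (K - V s)) (n + 1))
      ≤ M.expState π s (fun s => ENNReal.ofReal (K - V s)) n + (M.expReward π s n
      + M.expState π s (fun _ => ENNReal.ofReal K) (n + 1)) := by
    intro n
    have := M.expState_add_le π s n (M.measurable_stepLoss fun s => ENNReal.ofReal (K - V s))
      (M.measurable_stepGain K) (fun _ => ENNReal.ofReal K) (fun s => ENNReal.ofReal (K - V s))
      fun r => M.add_lintegral_stepLoss_le hK hV π n r (hbell n r)
    rwa [lintegral_discount_stepGain, lintegral_discount_stepLoss] at this
  -- No lower bound on V is assumed; finiteness propagates through `hstep`.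
  have hfin : ∀ n, M.expState π s (fun s => ENNReal.ofReal (K - V s)) n ≠ ⊤ := by
    intro n
    induction n with
    | zero =>
      rw [expState_zero]
      exact ENNReal.ofReal_ne_top
    | succ n ih =>
      refine ne_top_of_le_ne_top ?_ ((le_add_self.trans le_add_self).trans (hstep n))
      refine ENNReal.add_ne_top.2 ⟨ih, ENNReal.add_ne_top.2
        ⟨ne_top_of_le_ne_top hr (ENNReal.le_tsum n), ?_⟩⟩
      rw [expState_const]
      exact ENNReal.mul_ne_top ENNReal.ofReal_ne_top (ne_top_of_le_ne_top
        (ENNReal.pow_ne_top ENNReal.ofReal_ne_top) (M.expState_one_le π s (n + 1)))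
  have h := add_tsum_le_of_step_le hfin hstep
    (M.tendsto_expState_const π s (ENNReal.ofReal_ne_top (r := K)))
  rw [expState_zero, expState_zero] at h
  have hc : ∑' n, M.expCost π s n ≠ ⊤ :=
    ne_top_of_le_ne_top (ENNReal.add_ne_top.2 ⟨ENNReal.ofReal_ne_top, hr⟩) (le_add_self.trans h)
  generalize ∑' n, M.expReward π s n = x at *
  generalize ∑' n, M.expCost π s n = y at *
  lift x to NNReal using hr
  lift y to NNReal using hc
  rw [← ENNReal.ofReal_coe_nnreal (p := x), ← ENNReal.ofReal_coe_nnreal (p := y),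
    ← ENNReal.ofReal_add (sub_nonneg.2 (hV s)) x.coe_nonneg, ← ENNReal.ofReal_add hK y.coe_nonneg,
    ENNReal.ofReal_le_ofReal_iff (add_nonneg (sub_nonneg.2 (hV s)) x.coe_nonneg)] at h
  change _ ≤ ((x : ℝ) : EReal) - ((y : ℝ) : EReal)
  rw [← EReal.coe_sub, EReal.coe_le_coe_iff]
  linarith

/-- Stationary deterministic policy. -/
noncomputable def stationaryPolicy (f : State → Action) (hf : ∀ s, f s ∈ A s) : Policy A where
  choose n := Kernel.deterministic (fun r : History n => f (currentState r))
    ((measurable_of_countable f).comp measurable_currentState)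
  markov _ := inferInstance
  feasible n r := by
    rw [Kernel.deterministic_apply, Measure.dirac_apply' _ (Set.to_countable _).measurableSet]
    simp [hf]

/-- V need not solve a Bellman equation; this freedom admits the glued function in the final
comparison. -/
theorem le_optimalValue {K : ℝ} (hK : 0 ≤ K) {V : State → ℝ} (hV : ∀ s, V s ≤ K)
    (hbell : ∀ s, ∃ a ∈ A s, V s ≤ M.actionValue V s a) (s : State) :
    (V s : EReal) ≤ M.optimalValue A s := by
  choose f hf hfV using hbell
  refine (M.le_policyValue hK hV (stationaryPolicy f hf) (fun n r => ?_) s).trans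
    (le_iSup (fun π : Policy A => M.policyValue π s) _)
  change ∀ᵐ a ∂Kernel.deterministic (fun r : History n => f (currentState r))
    ((measurable_of_countable f).comp measurable_currentState) r, _
  rw [Kernel.deterministic_apply, ae_dirac_eq]
  exact hfV _

theorem optimalValue_eq {K : ℝ} (hK : 0 ≤ K) {V : State → ℝ} (hV : ∀ s, V s ≤ K)
    (hlow : ∀ s, -(M.h s.1 / M.beta) ≤ V s)
    (hle : ∀ s, ∀ a ∈ A s, M.actionValue V s a ≤ V s)
    (hge : ∀ s, ∃ a ∈ A s, V s ≤ M.actionValue V s a) (s : State) :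
    M.optimalValue A s = V s :=
  le_antisymm (iSup_le fun π => M.policyValue_le hK hV hlow hle π s)
    (M.le_optimalValue hK hV hge s)

end QueueModel

/-! ### Bellman solutions as value functions of the two problems -/

namespace QueueModel

variable (M : QueueModel)

/-- Extension of a value function `v` for the epochs without arrival to all epochs. -/
noncomputable def extend (v : ℕ → ℝ) (s : State) : ℝ := if s.2 then M.admitValue v s.1 else v s.1

theorem extend_false (v : ℕ → ℝ) (x : ℕ) : M.extend v (x, false) = v x := rfl

theorem extend_true (v : ℕ → ℝ) (x : ℕ) : M.extend v (x, true) = M.admitValue v x := rfl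

/-- Service rate. -/
def serviceRate (b : Bool) : ℝ := if b then M.muh else M.mul

/-- Cost rate of the service. -/
def serviceCost (b : Bool) : ℝ := if b then M.c else 0

/-- Uniformization: since λ + μ_h + β = 1, the Bellman equation rearranges to one whose denominator
is the true total rate plus β. An empty queue corresponds to d = 0. -/
theorem actionValue_le_of_service {g : ℝ → ℝ} {v : ℕ → ℝ} {s : State} {a : Action}
    (hv : M.bellman g v (queueAfter s a) = v (queueAfter s a))
    (h : ∀ d, M.serviceRate a.2 * d - M.serviceCost a.2 ≤ g d) :
    M.actionValue (M.extend v) s a ≤ M.stepReward s a + v (queueAfter s a) := by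
  have hpos : 0 < M.totalRate s a + M.beta := add_pos (M.totalRate_pos s a) M.beta_pos
  have hn := M.normalized
  unfold actionValue
  refine add_le_add_right ((div_le_iff₀ hpos).2 ?_) _
  rw [extend_true, extend_false]
  have hd : M.departureRate s a * (v (queueAfter s a - 1) - v (queueAfter s a))
      - M.serviceCost a.2 ≤ g (v (queueAfter s a - 1) - v (queueAfter s a)) := by
    unfold departureRate
    split_ifs with h0
    · have := h 0
      rw [h0, Nat.zero_sub, sub_self]
      simpa using this
    · simpa [serviceRate, *] using h (v (queueAfter s a - 1) - v (queueAfter s a))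
    · simpa [serviceRate, *] using h (v (queueAfter s a - 1) - v (queueAfter s a))
  have hc : M.costRate s a = M.h (queueAfter s a) + M.serviceCost a.2 := rfl
  have ht : M.totalRate s a = M.lam + M.departureRate s a := rfl
  have hq : (M.lam + M.muh + M.beta) * v (queueAfter s a) = v (queueAfter s a) := by
    rw [hn, one_mul]
  unfold bellman at hv
  rw [hc, ht]
  linarith

theorem le_actionValue_of_service {g : ℝ → ℝ} {v : ℕ → ℝ} {s : State} {a : Action}
    (hv : M.bellman g v (queueAfter s a) = v (queueAfter s a))
    (h : g (v (queueAfter s a - 1) - v (queueAfter s a))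
      ≤ M.departureRate s a * (v (queueAfter s a - 1) - v (queueAfter s a)) - M.serviceCost a.2) :
    M.stepReward s a + v (queueAfter s a) ≤ M.actionValue (M.extend v) s a := by
  have hpos : 0 < M.totalRate s a + M.beta := add_pos (M.totalRate_pos s a) M.beta_pos
  have hn := M.normalized
  unfold actionValue
  refine add_le_add_right ((le_div_iff₀ hpos).2 ?_) _
  rw [extend_true, extend_false]
  have hc : M.costRate s a = M.h (queueAfter s a) + M.serviceCost a.2 := rfl
  have ht : M.totalRate s a = M.lam + M.departureRate s a := rfl
  have hq : (M.lam + M.muh + M.beta) * v (queueAfter s a) = v (queueAfter s a) := by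
    rw [hn, one_mul]
  unfold bellman at hv
  rw [hc, ht]
  linarith

theorem actionValue_mono {V W : State → ℝ} (s : State) (a : Action)
    (h1 : V (queueAfter s a, true) ≤ W (queueAfter s a, true))
    (h2 : V (queueAfter s a - 1, false) ≤ W (queueAfter s a - 1, false)) :
    M.actionValue V s a ≤ M.actionValue W s a := by
  have hpos : 0 < M.totalRate s a + M.beta := add_pos (M.totalRate_pos s a) M.beta_pos
  have h3 := mul_le_mul_of_nonneg_left h1 M.lam_pos.le
  have h4 := mul_le_mul_of_nonneg_left h2 (M.departureRate_nonneg s a)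
  unfold actionValue
  refine add_le_add_right ((div_le_div_iff_of_pos_right hpos).2 ?_) _
  linarith

theorem stepReward_add_le (v : ℕ → ℝ) {s : State} {a : Action} (ha : a ∈ jointActions s) :
    M.stepReward s a + v (queueAfter s a) ≤ M.extend v s := by
  obtain ⟨x, i⟩ := s
  obtain ⟨y, b⟩ := a
  cases i <;> cases y
  · simp [stepReward, queueAfter, admitted, extend]
  · simp [jointActions] at ha
  · simp [stepReward, queueAfter, admitted, extend, admitValue]
  · simp [stepReward, queueAfter, admitted, extend, admitValue]

/-- Optimal admission decision for the value function `v`. -/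
noncomputable def optimalAdmit (v : ℕ → ℝ) (s : State) : Bool :=
  s.2 && decide (v s.1 ≤ M.R + v (s.1 + 1))

theorem optimalAdmit_mem (v : ℕ → ℝ) (s : State) (b : Bool) :
    (M.optimalAdmit v s, b) ∈ jointActions s := by
  simp only [jointActions, optimalAdmit, Set.mem_ofPred_eq, Bool.and_eq_true]
  exact fun h => h.1

theorem stepReward_add_optimalAdmit (v : ℕ → ℝ) (s : State) (b : Bool) :
    M.stepReward s (M.optimalAdmit v s, b) + v (queueAfter s (M.optimalAdmit v s, b))
      = M.extend v s := by
  obtain ⟨x, i⟩ := s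
  cases i
  · simp [stepReward, queueAfter, admitted, extend, optimalAdmit]
  · by_cases h : v x ≤ M.R + v (x + 1)
    · simp [stepReward, queueAfter, admitted, extend, optimalAdmit, h, admitValue]
    · simp [stepReward, queueAfter, admitted, extend, optimalAdmit, h, admitValue,
        (not_le.1 h).le]

/-- In an empty queue the truncated difference is 0, so the nominal rate may replace the true one.
-/
theorem departureRate_mul_burden (v : ℕ → ℝ) (s : State) (a : Action) :
    M.departureRate s a * (v (queueAfter s a - 1) - v (queueAfter s a))
      = M.serviceRate a.2 * (v (queueAfter s a - 1) - v (queueAfter s a)) := by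
  unfold departureRate serviceRate
  split_ifs with h0 <;> simp [h0]

/-- Net gain rate of the server in the joint problem. -/
noncomputable def jointGain (d : ℝ) : ℝ := max (M.mul * d) (M.muh * d - M.c)

/-- Net gain rate of the server that always uses the low rate. -/
noncomputable def lowGain (d : ℝ) : ℝ := M.mul * d

theorem delta_pos : 0 < M.delta := sub_pos.2 M.mul_lt_muh

/-- The gain is a maximum of lines with slopes μ_l and μ_h, both in [0, μ_h]. -/
theorem isServiceGain_jointGain : M.IsServiceGain M.jointGain where
  zero := by
    have := M.c_pos
    simp [jointGain, this.le]
  mono := fun a b h => max_le_max (mul_le_mul_of_nonneg_left h M.mul_pos.le)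
    (sub_le_sub_right (mul_le_mul_of_nonneg_left h M.muh_pos.le) _)
  mono_sub := fun a b h => by
    have h1 := mul_le_mul_of_nonneg_left h M.delta_pos.le
    unfold delta at h1
    simp only [jointGain]
    rcases max_cases (M.mul * b) (M.muh * b - M.c) with ⟨h2, -⟩ | ⟨h2, -⟩
    · linarith [le_max_left (M.mul * a) (M.muh * a - M.c)]
    · linarith [le_max_right (M.mul * a) (M.muh * a - M.c)]
  cont := by
    unfold jointGain
    fun_prop

theorem isServiceGain_lowGain : M.IsServiceGain M.lowGain where
  zero := mul_zero _
  mono := fun a b h => mul_le_mul_of_nonneg_left h M.mul_pos.le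
  mono_sub := fun a b h => by
    have h1 := mul_le_mul_of_nonneg_left h M.delta_pos.le
    unfold delta at h1
    simp only [lowGain]
    linarith
  cont := by
    unfold lowGain
    fun_prop

theorem service_le_jointGain (b : Bool) (d : ℝ) :
    M.serviceRate b * d - M.serviceCost b ≤ M.jointGain d := by
  cases b
  · simp [serviceRate, serviceCost, jointGain]
  · simp [serviceRate, serviceCost, jointGain]

theorem exists_jointGain_eq (d : ℝ) :
    ∃ b, M.jointGain d = M.serviceRate b * d - M.serviceCost b := by
  rcases max_choice (M.mul * d) (M.muh * d - M.c) with h | h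
  · exact ⟨false, by simp [serviceRate, serviceCost, jointGain, h]⟩
  · exact ⟨true, by simp [serviceRate, serviceCost, jointGain, h]⟩

theorem jointGain_eq_lowGain {d : ℝ} (h : d ≤ M.c / M.delta) : M.jointGain d = M.lowGain d := by
  rw [le_div_iff₀ M.delta_pos] at h
  unfold delta at h
  exact max_eq_left (by linarith)

theorem extend_le {v : ℕ → ℝ} (hv : ∀ x, v x ≤ M.lam * M.R / M.beta) (s : State) :
    M.extend v s ≤ M.R + M.lam * M.R / M.beta := by
  have := M.R_nonneg
  unfold extend admitValue
  split_ifs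
  · exact max_le (by linarith [hv (s.1 + 1)]) (by linarith [hv s.1])
  · linarith [hv s.1]

theorem le_extend {v : ℕ → ℝ} (hv : ∀ x, -(M.h x / M.beta) ≤ v x) (s : State) :
    -(M.h s.1 / M.beta) ≤ M.extend v s := by
  unfold extend admitValue
  split_ifs
  · exact (hv _).trans (le_max_right _ _)
  · exact hv _

theorem value_bound_nonneg : 0 ≤ M.R + M.lam * M.R / M.beta :=
  add_nonneg M.R_nonneg (div_nonneg (mul_nonneg M.lam_pos.le M.R_nonneg) M.beta_pos.le)

theorem value_eq {v : ℕ → ℝ} (hup : ∀ x, v x ≤ M.lam * M.R / M.beta)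
    (hlow : ∀ x, -(M.h x / M.beta) ≤ v x) (hv : ∀ x, M.bellman M.jointGain v x = v x) (s : State) :
    M.value s = M.extend v s := by
  refine M.optimalValue_eq M.value_bound_nonneg (M.extend_le hup) (M.le_extend hlow)
    (fun s a ha => ?_) (fun s => ?_) s
  · exact (M.actionValue_le_of_service (hv _)
      (M.service_le_jointGain _)).trans (M.stepReward_add_le v ha)
  · obtain ⟨b, hb⟩ := M.exists_jointGain_eq
      (v (queueAfter s (M.optimalAdmit v s, false) - 1)
        - v (queueAfter s (M.optimalAdmit v s, false)))
    refine ⟨(M.optimalAdmit v s, b), M.optimalAdmit_mem v s b, ?_⟩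
    rw [← M.stepReward_add_optimalAdmit v s b]
    refine M.le_actionValue_of_service (hv _) ?_
    rw [departureRate_mul_burden]
    exact hb.le

theorem valueHat_eq {v : ℕ → ℝ} (hup : ∀ x, v x ≤ M.lam * M.R / M.beta)
    (hlow : ∀ x, -(M.h x / M.beta) ≤ v x) (hv : ∀ x, M.bellman M.lowGain v x = v x) (s : State) :
    M.valueHat s = M.extend v s := by
  refine M.optimalValue_eq M.value_bound_nonneg (M.extend_le hup) (M.le_extend hlow)
    (fun s a ha => ?_) (fun s => ?_) s
  · refine (M.actionValue_le_of_service (hv _) fun d => ?_).trans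
      (M.stepReward_add_le v ha.1)
    rw [ha.2]
    simp [serviceRate, serviceCost, lowGain]
  · refine ⟨(M.optimalAdmit v s, false), ⟨M.optimalAdmit_mem v s false, rfl⟩, ?_⟩
    rw [← M.stepReward_add_optimalAdmit v s false]
    refine M.le_actionValue_of_service (hv _) ?_
    rw [departureRate_mul_burden]
    simp [serviceRate, serviceCost, lowGain]

/-! ### Thresholds -/

theorem threshold_eq_of_iff {f g : ℕ → EReal} {θ : ℝ} (h : ∀ k, f k ≤ θ ↔ g k ≤ θ) :
    threshold f θ = threshold g θ := by
  unfold threshold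
  simp only [h]

theorem le_threshold {f : ℕ → EReal} {θ : ℝ} {k : ℕ} (h : f k ≤ θ) :
    (k : EReal) ≤ threshold f θ :=
  le_sSup (Set.mem_insert_of_mem _ ⟨k, h, rfl⟩)

/-- By monotonicity the sublevel set is an initial segment; if it misses k, its supremum is at most
k - 1, which for k = 0 is the default value -1. -/
theorem le_of_le_one_add_threshold {f : ℕ → EReal} (hf : Monotone f) {θ : ℝ} {k : ℕ}
    (h : ((k + 1 : ℕ) : EReal) ≤ 1 + threshold f θ) : f k ≤ θ := by
  by_contra hk
  have hT : threshold f θ ≤ ((k - 1 : ℝ) : EReal) := by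
    refine sSup_le ?_
    rintro _ (rfl | ⟨j, hj, rfl⟩)
    · change ((-1 : ℝ) : EReal) ≤ _
      rw [EReal.coe_le_coe_iff]
      linarith [(Nat.cast_nonneg k : (0 : ℝ) ≤ k)]
    · have hjk : j + 1 ≤ k := by
        by_contra hn
        exact hk ((hf (by omega)).trans hj)
      change ((j : ℝ) : EReal) ≤ _
      rw [EReal.coe_le_coe_iff]
      have : ((j + 1 : ℕ) : ℝ) ≤ k := Nat.cast_le.2 hjk
      push_cast at this
      linarith
  have h2 := h.trans (add_le_add_right hT 1)
  change (((k + 1 : ℕ) : ℝ) : EReal) ≤ ((1 : ℝ) : EReal) + _ at h2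
  rw [← EReal.coe_add, EReal.coe_le_coe_iff] at h2
  push_cast at h2
  linarith

theorem HasIncreasingBurden.monotone {v : ℕ → ℝ} (hv : HasIncreasingBurden v) :
    Monotone fun k => v k - v (k + 1) :=
  monotone_nat_of_le_succ fun k => by simpa using hv (k + 1)

end QueueModel

/-! ### Comparison of the two problems -/

open QueueModel

theorem proposition2 (M : QueueModel) (hM : M.HoldingCostGrowth)
    (hB : M.admissionThreshold + 1 ≤ M.serviceThreshold) :
    M.admissionThresholdHat = M.admissionThreshold ∧
      ∀ (x : ℕ) (i : Bool), (x : EReal) ≤ M.serviceThreshold → M.flexibility (x, i) = 0 := by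
  obtain ⟨v, hvup, hvlow, hv, hvinc⟩ := M.exists_bellman_fixedPoint M.isServiceGain_jointGain
  obtain ⟨w, hwup, hwlow, hw, hwinc⟩ := M.exists_bellman_fixedPoint M.isServiceGain_lowGain
  have hval := M.value_eq hvup hvlow hv
  have hvalHat := M.valueHat_eq hwup hwlow hw
  have hbur : ∀ k, M.burden k = ((v k - v (k + 1) : ℝ) : EReal) := fun k => by
    rw [burden, hval, hval, EReal.coe_sub]
    rfl
  have hburHat : ∀ k, M.burdenHat k = ((w k - w (k + 1) : ℝ) : EReal) := fun k => by
    rw [burdenHat, hvalHat, hvalHat, EReal.coe_sub]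
    rfl
  have hburmono : Monotone M.burden := fun a b h => by
    rw [hbur, hbur, EReal.coe_le_coe_iff]
    exact hvinc.monotone h
  -- The 1 in the service threshold matches the shift: service at x is governed by the burden at x -
  -- 1, which for x = 0 is replaced by 0.
  have hlowservice : ∀ x : ℕ, (x : EReal) ≤ M.serviceThreshold →
      v (x - 1) - v x ≤ M.c / M.delta := by
    intro x hx
    rcases x with _ | k
    · simpa using div_nonneg M.c_pos.le M.delta_pos.le
    · have := le_of_le_one_add_threshold hburmono hx
      rwa [hbur, EReal.coe_le_coe_iff] at this
  have haccept : ∀ k, v k - v (k + 1) ≤ M.R → v k - v (k + 1) ≤ M.c / M.delta := by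
    intro k hk
    have h1 : (k : EReal) ≤ M.admissionThreshold :=
      le_threshold (by rwa [hbur, EReal.coe_le_coe_iff])
    have h2 : ((k + 1 : ℕ) : EReal) ≤ M.serviceThreshold := by
      refine le_trans ?_ hB
      rw [Nat.cast_add, Nat.cast_one]
      exact add_le_add_left h1 1
    simpa using hlowservice (k + 1) h2
  -- Low-rate actions are feasible in the joint problem, so the optimal decisions for `w` can be
  -- used there.
  have hwv : ∀ s, M.extend w s ≤ M.extend v s := by
    intro s
    rw [← EReal.coe_le_coe_iff, ← hval s]
    refine M.le_optimalValue M.value_bound_nonneg (M.extend_le hwup) (fun s => ?_) s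
    refine ⟨(M.optimalAdmit w s, false), M.optimalAdmit_mem w s false, ?_⟩
    rw [← M.stepReward_add_optimalAdmit w s false]
    refine M.le_actionValue_of_service (hw _) ?_
    rw [departureRate_mul_burden]
    simp [serviceRate, serviceCost, lowGain]
  have heq : ∀ s : State, v (s.1 - 1) - v s.1 ≤ M.c / M.delta → M.extend w s = M.extend v s := by
    classical
    let V : State → ℝ := fun s =>
      if v (s.1 - 1) - v s.1 ≤ M.c / M.delta then M.extend v s else M.extend w s
    have hwV : ∀ s, M.extend w s ≤ V s := fun s => by
      unfold V
      split_ifs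
      · exact hwv s
      · exact le_rfl
    have hVle : ∀ s, V s ≤ M.R + M.lam * M.R / M.beta := fun s => by
      unfold V
      split_ifs
      · exact M.extend_le hvup s
      · exact M.extend_le hwup s
    have hsub : ∀ s, ∃ a ∈ admissionActions s, V s ≤ M.actionValue V s a := by
      intro s
      by_cases hs : v (s.1 - 1) - v s.1 ≤ M.c / M.delta
      · have hVs : V s = M.extend v s := if_pos hs
        -- The queue after the decision is still in the low-rate region: by `haccept` if a customer
        -- is admitted, by `hs` otherwise.
        have hq : v (queueAfter s (M.optimalAdmit v s, false) - 1)
            - v (queueAfter s (M.optimalAdmit v s, false)) ≤ M.c / M.delta := by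
          unfold queueAfter
          split_ifs with ha
          · rw [Nat.add_sub_cancel]
            simp only [admitted, optimalAdmit, Bool.and_eq_true, decide_eq_true_eq] at ha
            exact haccept _ (by linarith [ha.2.2])
          · exact hs
        refine ⟨(M.optimalAdmit v s, false), ⟨M.optimalAdmit_mem v s false, rfl⟩, ?_⟩
        rw [hVs, ← M.stepReward_add_optimalAdmit v s false]
        refine (M.le_actionValue_of_service (hv _) ?_).trans (M.actionValue_mono s _ ?_ ?_)
        · rw [departureRate_mul_burden, M.jointGain_eq_lowGain hq]
          simp [serviceRate, serviceCost, lowGain]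
        · exact (if_pos hq).ge
        -- A departure stays in the region because burdens increase.
        · have hq2 := hq
          generalize queueAfter s (M.optimalAdmit v s, false) = q at hq2 ⊢
          refine (if_pos (?_ : v (q - 1 - 1) - v (q - 1) ≤ _)).ge
          rcases q with _ | q
          · exact hq2
          · exact (hvinc q).trans hq2
      · have hVs : V s = M.extend w s := if_neg hs
        refine ⟨(M.optimalAdmit w s, false), ⟨M.optimalAdmit_mem w s false, rfl⟩, ?_⟩
        rw [hVs, ← M.stepReward_add_optimalAdmit w s false]
        refine (M.le_actionValue_of_service (hw _) ?_).trans
          (M.actionValue_mono s _ (hwV _) (hwV _))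
        rw [departureRate_mul_burden]
        simp [serviceRate, serviceCost, lowGain]
    intro s hs
    refine le_antisymm (hwv s) ?_
    have h := M.le_optimalValue M.value_bound_nonneg hVle hsub s
    rw [show V s = M.extend v s from if_pos hs] at h
    rw [← EReal.coe_le_coe_iff, ← hvalHat s]
    exact h
  have hle : ∀ k, w k ≤ v k := fun k => hwv (k, false)
  have heqx : ∀ k, v (k - 1) - v k ≤ M.c / M.delta → w k = v k := fun k => heq (k, false)
  refine ⟨threshold_eq_of_iff fun k => ?_, fun x i hx => ?_⟩
  · rw [hbur, hburHat, EReal.coe_le_coe_iff, EReal.coe_le_coe_iff]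
    constructor
    · intro hk
      by_contra hcon
      classical
      have hex : ∃ j, ¬ v j - v (j + 1) ≤ M.R := ⟨k, hcon⟩
      have hmin := Nat.find_spec hex
      have hjk : Nat.find hex ≤ k := Nat.find_min' hex hcon
      -- By minimality the preceding burden is at most R, so the first rejecting state lies in the
      -- region where `w` and `v` agree.
      have hpre : v (Nat.find hex - 1) - v (Nat.find hex) ≤ M.c / M.delta := by
        rcases hj : Nat.find hex with _ | j
        · simpa using div_nonneg M.c_pos.le M.delta_pos.le
        · have := Nat.find_min hex (m := j) (by omega)
          exact haccept j (not_not.1 this)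
      have h1 := heqx _ hpre
      have h2 := hle (Nat.find hex + 1)
      have h3 := hwinc.monotone hjk
      simp only at h3
      exact hmin (by linarith)
    · intro hk
      have h1 := haccept k hk
      rw [heqx k ((hvinc k).trans h1), heqx (k + 1) (by simpa using h1)]
      exact hk
  · rw [flexibility, hval, hvalHat, heq (x, i) (hlowservice x hx), ← EReal.coe_sub, sub_self,
      EReal.coe_zero]
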